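/- **Setting.** Let $\tilde{\mathcal T}_h$ be a finite conforming triangulation of a polygonal domain $\tilde\Omega_h\subset\mathbb R^2$ (the interior of the union of its closed triangles). Put $h_T=\operatorname{diam}\tilde T$, and assume that $\tilde{\mathcal T}_h$ is shape regular with constant $\sigma$: each $\tilde T$ contains a disc of radius $r$ with $h_T\le\sigma r$. No triangle has three boundary vertices, and the boundary vertices lie on the boundary of an open set $\Omega$. Let $G$ be continuous on $\overline{\tilde\Omega_h}$, map $\tilde\Omega_h$ bijectively onto $\Omega$ and fix all vertices. Let $G_h$ be its piecewise quadratic nodal interpolant (nodes: vertices and edge midpoints of $\tilde{\mathcal T}_h$). Assume that interior edges stay straight ($G$ fixes their midpoints, so that $G_h$ is the identity on them), that $G_h$ is injective on each closed triangle, and that $|DG_h|$, $|D^2G_h|$ and $|(DG_h)^{-1}|$ are bounded by $M$ on each triangle. The curved triangles are $T=G_h(\tilde T)$. Let $\hat T$ be the reference triangle with vertices $(0,0),(1,0),(0,1)$, $F_{\tilde T}:\hat T\to\tilde T$ an affine bijection, $F_T=G_h\circ F_{\tilde T}$, and $A_T=DF_T/\det DF_T$. **Spaces.** Let $\hat K_1,\hat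 K_2,\hat K_3$ be the triangles obtained by joining the vertices of $\hat T$ to its barycenter, and let $$\hat{\boldsymbol V}=\{\hat{\boldsymbol v}\in \boldsymbol H^1(\hat T):\ \hat{\boldsymbol v}|_{\hat K_i}\in[\mathcal P_2(\hat K_i)]^2,\ i=1,2,3\},$$ with members represented by continuous functions. Let $$\boldsymbol V(T)=\{\boldsymbol v\in\boldsymbol H^1(T):\ \boldsymbol v\circ F_T=A_T\hat{\boldsymbol v}\text{ for some }\hat{\boldsymbol v}\in\hat{\boldsymbol V}\},$$ $$\tilde{\boldsymbol V}^h=\{\tilde{\boldsymbol v}\in\boldsymbol H^1_0(\tilde\Omega_h):\ \tilde{\boldsymbol v}|_{\tilde T}\circ F_{\tilde T}\in\hat{\boldsymbol V}\ \text{for all }\tilde T\in\tilde{\mathcal T}_h\}.$$ The space $\boldsymbol V^h$ consists of the piecewise defined fields $\boldsymbol v$ with $\boldsymbol v|_T\in\boldsymbol V(T)$ for every $T$ for which there is $\tilde{\boldsymbol v}\in\tilde{\boldsymbol V}^h$ such that $\boldsymbol v|_T(F_T(\hat a))=\tilde{\boldsymbol v}(F_{\tilde T}(\hat a))$ for all $T$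 and for the ten points $\hat a$ that are vertices or edge midpoints of the split triangulation $\{\hat K_1,\hat K_2,\hat K_3\}$. **Claim.** There is a constant $C>0$ depending only on $\sigma$ and $M$ (in particular not on the mesh size) such that, for every such mesh, every interior edge $e=\partial T_+\cap\partial T_-$ and every $\boldsymbol v\in\boldsymbol V^h$, $$\Big|\int_e[\boldsymbol v]\Big|\le C\,h_T^3\big(\|\nabla\boldsymbol v\|_{L^2(T_+)}+\|\nabla\boldsymbol v\|_{L^2(T_-)}\big),\qquad h_T=\max\{h_{T_+},h_{T_-}\},$$ where $[\boldsymbol v]=\boldsymbol v_+\otimes\boldsymbol n_++\boldsymbol v_-\otimes\boldsymbol n_-$, $\boldsymbol v_\pm$ is the restriction of $\boldsymbol v$ to $T_\pm$, and $\boldsymbol n_\pm$ is the outward unit normal of $\partial T_\pm$ on $e$. The integrals that occur exist. -/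

import Mathlib

open Set MeasureTheory
open scoped ContDiff

noncomputable section

/-- The Euclidean plane. -/
abbrev Plane : Type := EuclideanSpace ℝ (Fin 2)

namespace Plane

/-! ### Sobolev spaces on a plane open set -/

/-- The classical partial derivative of a scalar function. -/
def partialDeriv (b : Fin 2) (u : Plane → ℝ) (x : Plane) : ℝ :=
  fderiv ℝ u x (EuclideanSpace.single b 1)

/-- Test functions on `U`: smooth with compact support contained in `U`. -/
def IsTestFunction (U : Set Plane) (φ : Plane → ℝ) : Prop :=
  ContDiff ℝ ∞ φ ∧ HasCompactSupport φ ∧ tsupport φ ⊆ U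

/-- `g` is the weak partial derivative of `u` in direction `b` on `U`. -/
def HasWeakPartial (U : Set Plane) (b : Fin 2) (u g : Plane → ℝ) : Prop :=
  ∀ φ : Plane → ℝ, IsTestFunction U φ →
    ∫ x in U, u x * partialDeriv b φ x = -∫ x in U, g x * φ x

/-- The scalar Sobolev space `H¹(U)`. -/
def MemH1 (U : Set Plane) (u : Plane → ℝ) : Prop :=
  MemLp u 2 (volume.restrict U) ∧
    ∀ b : Fin 2, ∃ g : Plane → ℝ, MemLp g 2 (volume.restrict U) ∧ HasWeakPartial U b u g

/-- The scalar Sobolev space `H¹₀(U)`: the closure of the test functions in `H¹(U)`. -/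
def MemH10 (U : Set Plane) (u : Plane → ℝ) : Prop :=
  MemLp u 2 (volume.restrict U) ∧
    ∃ g : Fin 2 → Plane → ℝ,
      (∀ b, MemLp (g b) 2 (volume.restrict U) ∧ HasWeakPartial U b u (g b)) ∧
      ∃ φ : ℕ → Plane → ℝ, (∀ n, IsTestFunction U (φ n)) ∧
        Filter.Tendsto (fun n => eLpNorm (fun x => φ n x - u x) 2 (volume.restrict U))
          Filter.atTop (nhds 0) ∧
        ∀ b, Filter.Tendsto
          (fun n => eLpNorm (fun x => partialDeriv b (φ n) x - g b x) 2 (volume.restrict U))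
          Filter.atTop (nhds 0)

/-- The vector-valued space `𝐇¹(U) = H¹(U)²`. -/
def VecMemH1 (U : Set Plane) (v : Plane → Plane) : Prop :=
  ∀ a : Fin 2, MemH1 U (fun x => v x a)

/-- The vector-valued space `𝐇¹₀(U) = H¹₀(U)²`. -/
def VecMemH10 (U : Set Plane) (v : Plane → Plane) : Prop :=
  ∀ a : Fin 2, MemH10 U (fun x => v x a)

/-- On `S`, both components of `v` are polynomials of total degree at most two. -/
def IsQuadraticOn (S : Set Plane) (v : Plane → Plane) : Prop :=
  ∀ a : Fin 2, ∃ p : MvPolynomial (Fin 2) ℝ, p.totalDegree ≤ 2 ∧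
    ∀ x ∈ S, v x a = MvPolynomial.eval (fun b => x b) p

/-- The squared Frobenius norm of the gradient `(∂_b v_a)_{a,b}`. -/
def gradSq (v : Plane → Plane) (x : Plane) : ℝ :=
  ∑ a : Fin 2, ∑ b : Fin 2, (fderiv ℝ v x (EuclideanSpace.single b 1) a) ^ 2

/-- The norm `‖∇v‖_{L²(T)}` of a piecewise smooth vector field. -/
def gradNorm (T : Set Plane) (v : Plane → Plane) : ℝ :=
  Real.sqrt (∫ x in T, gradSq v x)

/-! ### The reference triangle and its Clough-Tocher split

Edge number `k` of a triangle is the edge opposite vertex `k`, whose end points are the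
vertices `k + 1` and `k + 2` (modulo three). -/

/-- The vertices `(0,0)`, `(1,0)`, `(0,1)` of the reference triangle. -/
def refVertex : Fin 3 → Plane := ![!₂[0, 0], !₂[1, 0], !₂[0, 1]]

/-- The barycentric coordinates of the reference triangle. -/
def refBary (k : Fin 3) (x : Plane) : ℝ := ![1 - x 0 - x 1, x 0, x 1] k

/-- The (closed) reference triangle. -/
def refTriangle : Set Plane := convexHull ℝ (range refVertex)

/-- The barycenter of the reference triangle. -/
def refCenter : Plane := !₂[1 / 3, 1 / 3]

/-- The three (closed) triangles of the Clough-Tocher split. -/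
def refCell (k : Fin 3) : Set Plane :=
  convexHull ℝ {refCenter, refVertex (k + 1), refVertex (k + 2)}

/-- The four vertices and six edge midpoints of the Clough-Tocher split. -/
def refNodes : Set Plane :=
  range refVertex ∪ {refCenter} ∪
    range (fun k : Fin 3 => midpoint ℝ (refVertex (k + 1)) (refVertex (k + 2))) ∪
    range (fun k : Fin 3 => midpoint ℝ refCenter (refVertex k))

/-- The reference velocity space: `𝐇¹` fields that are quadratic on each cell of the
Clough-Tocher split. Such a field has a continuous representative, and it is this
representative that we work with, since point values are used. -/
def refVelocity : Set (Plane → Plane) :=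
  {v | ContinuousOn v refTriangle ∧ VecMemH1 (interior refTriangle) v ∧
    ∀ k : Fin 3, IsQuadraticOn (refCell k) v}

/-- The affine map of the reference triangle onto the triangle `p`, vertex to vertex. -/
def affineMap (p : AffineBasis (Fin 3) ℝ Plane) (x : Plane) : Plane :=
  ∑ k : Fin 3, refBary k x • p k

/-- The nodal interpolant of `G` on the triangle `p` of polynomial degree two (interpolation
at the three vertices and at the three edge midpoints), in its Lagrange form. -/
def quadInterp (p : AffineBasis (Fin 3) ℝ Plane) (G : Plane → Plane) (x : Plane) : Plane :=
  ∑ k : Fin 3, (p.coord k x * (2 * p.coord k x - 1)) • G (p k) +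
    ∑ k : Fin 3, (4 * p.coord (k + 1) x * p.coord (k + 2) x) •
      G (midpoint ℝ (p (k + 1)) (p (k + 2)))

end Plane

open Plane

/-! ### Triangulations -/

/-- A finite conforming triangulation by nondegenerate (affine) triangles, each given with a
numbering of its vertices. -/
structure AffineTriangulation (ι : Type) [Fintype ι] where
  /-- The vertices of the triangles. -/
  tri : ι → AffineBasis (Fin 3) ℝ Plane
  distinct : ∀ i j, range (tri i) = range (tri j) → i = j
  conforming : ∀ i j, convexHull ℝ (range (tri i)) ∩ convexHull ℝ (range (tri j)) =
    convexHull ℝ (range (tri i) ∩ range (tri j))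

namespace AffineTriangulation

variable {ι : Type} [Fintype ι] (m : AffineTriangulation ι)

/-- The closed affine triangle number `i`. -/
def cell (i : ι) : Set Plane := convexHull ℝ (range (m.tri i))

/-- The diameter `h_T` of the affine triangle number `i`. -/
def size (i : ι) : ℝ := Metric.diam (m.cell i)

/-- The polygonal domain: the interior of the union of the closed triangles. -/
def polygon : Set Plane := interior (⋃ i, m.cell i)

/-- Edge number `k` of triangle number `i`. -/
def edge (i : ι) (k : Fin 3) : Set Plane := segment ℝ (m.tri i (k + 1)) (m.tri i (k + 2))

/-- Shape regularity with constant `σ`: each triangle contains a ball of radius at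
least `h_T / σ`. -/
def ShapeRegular (σ : ℝ) : Prop :=
  ∀ i, ∃ (c : Plane) (r : ℝ), 0 < r ∧ Metric.closedBall c r ⊆ m.cell i ∧ m.size i ≤ σ * r

end AffineTriangulation

/-- An isoparametric triangulation of a domain `Ω`: an affine triangulation whose boundary
vertices lie on `∂Ω` and whose triangles have at most two boundary vertices, with a bijection
`G` of the polygonal domain onto `Ω` that fixes all vertices. The curved triangles are the
images of the affine ones under the piecewise quadratic interpolant `G_h` of `G`. -/
structure IsoparametricMesh (ι : Type) [Fintype ι] extends AffineTriangulation ι where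
  /-- The domain. -/
  Ω : Set Plane
  isOpen_Ω : IsOpen Ω
  boundary_vertex : ∀ i k, tri i k ∈ frontier toAffineTriangulation.polygon →
    tri i k ∈ frontier Ω
  /-- Not all three vertices of a triangle are boundary vertices. -/
  interior_vertex : ∀ i, ∃ k, tri i k ∉ frontier toAffineTriangulation.polygon
  /-- The map of the polygonal domain onto the domain. -/
  G : Plane → Plane
  continuousOn_G : ContinuousOn G (closure toAffineTriangulation.polygon)
  bijOn_G : BijOn G toAffineTriangulation.polygon Ω
  G_vertex : ∀ i k, G (tri i k) = tri i k
  /-- Interior edges stay straight: `G_h` fixes the end points of each interior edge, and by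
  this condition its midpoint, so that `G_h` is the identity on the edge. -/
  straight : ∀ i j k l, i ≠ j →
    toAffineTriangulation.edge i k = toAffineTriangulation.edge j l →
    G (midpoint ℝ (tri i (k + 1)) (tri i (k + 2))) = midpoint ℝ (tri i (k + 1)) (tri i (k + 2))
  injOn_Gh : ∀ i, InjOn (quadInterp (tri i) G) (toAffineTriangulation.cell i)

namespace IsoparametricMesh

variable {ι : Type} [Fintype ι] (m : IsoparametricMesh ι)

/-- The interpolant `G_h` on triangle number `i`. -/
def Gh (i : ι) : Plane → Plane := quadInterp (m.tri i) m.G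

/-- On each affine triangle, `‖DG_h‖_{W^{1,∞}}` and the maximum norm of `(DG_h)⁻¹` are at
most `M`. -/
def MapBound (M : ℝ) : Prop :=
  ∀ i, ∀ x ∈ m.cell i,
    ‖fderiv ℝ (m.Gh i) x‖ ≤ M ∧ ‖fderiv ℝ (fderiv ℝ (m.Gh i)) x‖ ≤ M ∧
    (fderiv ℝ (m.Gh i) x).IsInvertible ∧ ‖(fderiv ℝ (m.Gh i) x).inverse‖ ≤ M

/-- The curved triangle `T = G_h(T̃)` (closed). -/
def curved (i : ι) : Set Plane := m.Gh i '' m.cell i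

/-- The affine map of the reference triangle onto `T̃`. -/
def affMap (i : ι) : Plane → Plane := affineMap (m.tri i)

/-- The quadratic map `F_T = G_h ∘ F_T̃` of the reference triangle onto `T`. -/
def F (i : ι) : Plane → Plane := m.Gh i ∘ m.affMap i

/-- The Piola matrix `A_T = DF_T / det DF_T`. -/
def A (i : ι) (x : Plane) : Plane →L[ℝ] Plane :=
  (fderiv ℝ (m.F i) x).det⁻¹ • fderiv ℝ (m.F i) x

/-- The local velocity space on `T`, defined by the Piola transform. Functions are considered
on the closed set `T` only; their values elsewhere are irrelevant. -/
def localVelocity (i : ι) : Set (Plane → Plane) :=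
  {v | VecMemH1 (interior (m.curved i)) v ∧
    ∃ w ∈ refVelocity, ∀ x ∈ refTriangle, v (m.F i x) = m.A i x (w x)}

/-- The global velocity space on the affine triangulation: `𝐇¹₀` fields that on each triangle
are a field of the reference space composed with the inverse of the affine map (represented by
their continuous representatives on the closed polygonal domain). -/
def affineVelocity : Set (Plane → Plane) :=
  {v | ContinuousOn v (closure m.polygon) ∧ VecMemH10 m.polygon v ∧
    ∀ i, ∃ w ∈ refVelocity, ∀ x ∈ refTriangle, v (m.affMap i x) = w x}

/-- The global velocity space `𝐕ʰ` on the curved triangulation. A member is the family of its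
restrictions to the closed triangles. It is the image of a member `u` of the space on
the affine triangulation under the map that preserves the values at the ten nodes of each
triangle. -/
def velocity : Set (ι → Plane → Plane) :=
  {v | ∃ u ∈ m.affineVelocity, ∀ i, v i ∈ m.localVelocity i ∧
    ∀ x ∈ refNodes, v i (m.F i x) = u (m.affMap i x)}

/-- `n` is the outward unit normal of `T` along its edge number `k`: at each relatively interior
point `F_T(x)` of the edge, the tangent cone of `T`, which is spanned by the vectors
`DF_T(x)(y - x)` with `y` in the reference triangle, lies in the half-plane `⟪n, ·⟫ ≤ 0`. -/
def IsOutwardNormal (i : ι) (k : Fin 3) (n : Plane) : Prop :=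
  ‖n‖ = 1 ∧ ∀ x ∈ openSegment ℝ (refVertex (k + 1)) (refVertex (k + 2)), ∀ y ∈ refTriangle,
    inner ℝ n (fderiv ℝ (m.F i) x (y - x)) ≤ 0

end IsoparametricMesh

/-! ### Jumps -/

/-- The jump `v₊ ⊗ n₊ + v₋ ⊗ n₋`. -/
def jump (vp vn : Plane → Plane) (np nn : Plane) (x : Plane) : Matrix (Fin 2) (Fin 2) ℝ :=
  Matrix.of fun a b => vp x a * np b + vn x a * nn b

/-- The integral of a matrix function over the segment from `p` to `q` with respect to arc
length, entry by entry. -/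
def edgeIntegral (p q : Plane) (J : Plane → Matrix (Fin 2) (Fin 2) ℝ) :
    Matrix (Fin 2) (Fin 2) ℝ :=
  Matrix.of fun a b => dist p q * ∫ t in (0 : ℝ)..1, J (AffineMap.lineMap p q t) a b

/-- The Frobenius norm of a matrix. -/
def frobNorm (J : Matrix (Fin 2) (Fin 2) ℝ) : ℝ := Real.sqrt (∑ a, ∑ b, J a b ^ 2)

end

noncomputable section

namespace Plane

/-! ### Polynomial functions on the plane -/

/-! An interior edge `e` is straight and `F_T` is affine along it, so the two outward normals are
constant and opposite (`IsOutwardNormal.eq_neg`), and the jump is the difference of the traces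
tensored with one normal. Both traces take the values of the same field `u` at the end points and at
the midpoint of `e`. Simpson's rule therefore gives the same value on both sides, and the integral
of the difference is `|e|` times the difference of the two Simpson errors. As `|e| ≤ h`, it remains
to bound each Simpson error on the unit interval by `C h² ‖∇v‖`.

This is done in `IsQuadChart.abs_simpsonError_piola_le`. Let `c` be the value of the trace at one
end point and `B` a bound for the derivatives of `v ∘ F`. In dimension two the adjugate of `DF` is
affine, and the Piola transform of `adj(DF) c` is the constant `c`. Hence `v ∘ F = c + (DF / det DF)
ζ` along the edge, where `ζ` is quadratic and of size `h B`. Since `DF` has size `h` and oscillation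
`h²`, while `det DF` is at least of order `h²`, the matrix `DF / det DF` is affine along the edge up
to a remainder of size `h`. The affine part times `ζ` is cubic, and Simpson's rule integrates it
exactly. What remains is of size `h · h B`.

The bound `B ≤ C ‖∇v‖` (`IsQuadChart.exists_abs_partialDeriv_piola_le`) is an inverse estimate: up
to the factor `(det DF)²` the derivatives of `v ∘ F` are polynomials of degree at most five on a
cell of the split, and the `L²`-norm of a gradient is scale invariant in the plane.

On the geometric side, `isQuadChart_F` derives the bounds for `DF` from shape regularity and
`MapBound`. A triangle has a vertex that is not a boundary vertex; the two edges at that vertex are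
shared, hence straight, so `F_T` is affine plus one edge bubble (`exists_bubble`). This makes `F_T`
affine along interior edges and fixes the side to which an outward normal points. -/

/-- `f` is a polynomial function of total degree at most `N`. -/
def IsPolyFun (N : ℕ) (f : Plane → ℝ) : Prop :=
  ∃ p : MvPolynomial (Fin 2) ℝ, p.totalDegree ≤ N ∧
    ∀ x, f x = MvPolynomial.eval (fun b => x b) p

theorem IsPolyFun.mono {N N' : ℕ} {f : Plane → ℝ} (hf : IsPolyFun N f) (h : N ≤ N') : IsPolyFun N' f := by
  obtain ⟨p, hp, hpf⟩ := hf
  exact ⟨p, hp.trans h, hpf⟩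

theorem IsPolyFun.const (N : ℕ) (c : ℝ) : IsPolyFun N (fun _ => c) :=
  ⟨MvPolynomial.C c, by simp, fun x => by simp⟩

theorem IsPolyFun.coord (b : Fin 2) : IsPolyFun 1 (fun x => x b) :=
  ⟨MvPolynomial.X b, by simp, fun x => by simp⟩

theorem IsPolyFun.add {N : ℕ} {f g : Plane → ℝ} (hf : IsPolyFun N f) (hg : IsPolyFun N g) :
    IsPolyFun N (fun x => f x + g x) := by
  obtain ⟨p, hp, hpf⟩ := hf
  obtain ⟨q, hq, hqg⟩ := hg
  exact ⟨p + q, (MvPolynomial.totalDegree_add p q).trans (max_le hp hq),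
    fun x => by simp [hpf, hqg]⟩

theorem IsPolyFun.mul {N N' : ℕ} {f g : Plane → ℝ} (hf : IsPolyFun N f) (hg : IsPolyFun N' g) :
    IsPolyFun (N + N') (fun x => f x * g x) := by
  obtain ⟨p, hp, hpf⟩ := hf
  obtain ⟨q, hq, hqg⟩ := hg
  exact ⟨p * q, (MvPolynomial.totalDegree_mul p q).trans (add_le_add hp hq),
    fun x => by simp [hpf, hqg]⟩

theorem IsPolyFun.const_mul {N : ℕ} {f : Plane → ℝ} (hf : IsPolyFun N f) (c : ℝ) :
    IsPolyFun N (fun x => c * f x) := by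
  simpa using (IsPolyFun.const 0 c).mul hf

theorem IsPolyFun.sub {N : ℕ} {f g : Plane → ℝ} (hf : IsPolyFun N f) (hg : IsPolyFun N g) :
    IsPolyFun N (fun x => f x - g x) := by
  simpa [sub_eq_add_neg] using hf.add (hg.const_mul (-1))

theorem hasFDerivAt_eval (p : MvPolynomial (Fin 2) ℝ) (x : Plane) :
    HasFDerivAt (fun x : Plane => MvPolynomial.eval (fun b => x b) p)
      (∑ b, MvPolynomial.eval (fun b => x b) (MvPolynomial.pderiv b p) •
        (EuclideanSpace.proj b : Plane →L[ℝ] ℝ)) x := by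
  induction p using MvPolynomial.induction_on with
  | C a => simpa using hasFDerivAt_const a x
  | add p q hp hq =>
    have := hp.add hq
    simp only [map_add, add_smul, Finset.sum_add_distrib]
    exact this
  | mul_X p c hp =>
    have h := hp.mul ((EuclideanSpace.proj c : Plane →L[ℝ] ℝ).hasFDerivAt (x := x))
    simp only [map_mul, MvPolynomial.eval_X]
    refine h.congr_fderiv ?_
    ext w
    fin_cases c <;> simp [Fin.sum_univ_two, MvPolynomial.pderiv_X] <;> ring

theorem totalDegree_pderiv_le (p : MvPolynomial (Fin 2) ℝ) (b : Fin 2) :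
    (MvPolynomial.pderiv b p).totalDegree ≤ p.totalDegree := by
  conv_lhs => rw [p.as_sum, map_sum]
  refine MvPolynomial.totalDegree_finsetSum_le fun s hs => ?_
  rw [MvPolynomial.pderiv_monomial]
  refine (MvPolynomial.totalDegree_monomial_le _ _).trans ?_
  refine le_trans ?_ (MvPolynomial.le_totalDegree hs)
  change Finsupp.degree _ ≤ Finsupp.degree _
  exact Finsupp.degree_mono tsub_le_self

theorem IsPolyFun.differentiable {N : ℕ} {f : Plane → ℝ} (hf : IsPolyFun N f) : Differentiable ℝ f := by
  obtain ⟨p, -, hpf⟩ := hf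
  rw [funext hpf]
  exact fun x => (hasFDerivAt_eval p x).differentiableAt

theorem IsPolyFun.continuous {N : ℕ} {f : Plane → ℝ} (hf : IsPolyFun N f) : Continuous f :=
  hf.differentiable.continuous

theorem IsPolyFun.partialDeriv {N : ℕ} {f : Plane → ℝ} (hf : IsPolyFun N f) (b : Fin 2) :
    IsPolyFun N (partialDeriv b f) := by
  obtain ⟨p, hp, hpf⟩ := hf
  refine ⟨MvPolynomial.pderiv b p, (totalDegree_pderiv_le p b).trans hp, fun x => ?_⟩
  rw [funext hpf, Plane.partialDeriv, (hasFDerivAt_eval p x).fderiv]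
  fin_cases b <;> simp [Fin.sum_univ_two]

/-- Along a line, a polynomial function is a polynomial of the same degree in the parameter. -/
theorem IsPolyFun.comp_lineMap {N : ℕ} {f : Plane → ℝ} (hf : IsPolyFun N f) (p q : Plane) :
    ∃ P : Polynomial ℝ, P.natDegree ≤ N ∧ ∀ t : ℝ, f (AffineMap.lineMap p q t) = P.eval t := by
  obtain ⟨r, hr, hrf⟩ := hf
  refine ⟨MvPolynomial.aeval
    (fun b => Polynomial.C (p b) + Polynomial.C (q b - p b) * Polynomial.X) r, ?_, fun t => ?_⟩
  · simpa using MvPolynomial.aeval_natDegree_le r hr _ (n := 1) fun b => by compute_degree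
  · rw [hrf, ← Polynomial.coe_evalRingHom, MvPolynomial.aeval_def, MvPolynomial.hom_eval₂,
      MvPolynomial.eval]
    change MvPolynomial.eval₂ _ _ _ = _
    congr 1
    · ext; simp
    · ext b
      simp [AffineMap.lineMap_apply]
      ring

/-- An open set contains a box, that is, a product of infinite sets of reals, and a polynomial
vanishing on such a product is zero. -/
theorem eq_zero_of_eval_eq_zero {U : Set Plane} (hU : IsOpen U) (hne : U.Nonempty)
    (p : MvPolynomial (Fin 2) ℝ) (h : ∀ x ∈ U, MvPolynomial.eval (fun b => x b) p = 0) : p = 0 := by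
  obtain ⟨x, hx⟩ := hne
  have hU' : IsOpen ((WithLp.toLp 2 : (Fin 2 → ℝ) → Plane) ⁻¹' U) :=
    hU.preimage (PiLp.continuous_toLp 2 _)
  obtain ⟨ε, hε, hb⟩ := Metric.isOpen_iff.1 hU' (WithLp.ofLp x) hx
  have : ∀ b : Fin 2, (Metric.ball (x b) ε).Infinite := fun b => by
    rw [Real.ball_eq_Ioo]
    exact Set.Ioo_infinite (by linarith)
  refine MvPolynomial.funext_set (R := ℝ) (p := p) (q := 0) (fun b : Fin 2 => Metric.ball (x b) ε) this fun y hy => ?_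
  have := h (WithLp.toLp 2 y) (hb (by
    rw [ball_pi _ hε]
    exact hy))
  simpa using this

/-- Inverse estimate: polynomials of bounded degree are bounded on a bounded set by their
`L²`-norm on a nonempty open bounded set. -/
theorem exists_inverse_estimate (N : ℕ) {U S : Set Plane} (hU : IsOpen U) (hne : U.Nonempty)
    (hUb : Bornology.IsBounded U) (hS : IsCompact S) :
    ∃ C : ℝ, 0 ≤ C ∧ ∀ f : Plane → ℝ, IsPolyFun N f → ∀ x ∈ S,
      |f x| ≤ C * Real.sqrt (∫ x in U, f x ^ 2) := by
  let V := MvPolynomial.restrictTotalDegree (Fin 2) ℝ N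
  have hc : ∀ p : MvPolynomial (Fin 2) ℝ,
      Continuous fun x : Plane => MvPolynomial.eval (fun b => x b) p := fun p =>
    (IsPolyFun.continuous ⟨p, le_rfl, fun _ => rfl⟩)
  have hfin : IsFiniteMeasure (volume.restrict U) :=
    ⟨by rw [Measure.restrict_apply_univ]; exact hUb.measure_lt_top⟩
  have hL : ∀ p : MvPolynomial (Fin 2) ℝ,
      MemLp (fun x : Plane => MvPolynomial.eval (fun b => x b) p) 2 (volume.restrict U) := by
    intro p
    obtain ⟨B, hB⟩ := hUb.isCompact_closure.exists_bound_of_continuousOn (hc p).continuousOn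
    refine MemLp.of_bound (hc p).aestronglyMeasurable B ?_
    refine (ae_restrict_iff' hU.measurableSet).2 (Filter.Eventually.of_forall fun x hx => ?_)
    exact hB x (subset_closure hx)
  let T : V →ₗ[ℝ] Lp ℝ 2 (volume.restrict U) :=
    { toFun := fun p => (hL p.1).toLp _
      map_add' := fun p q => by
        rw [← MemLp.toLp_add]
        congr 1
        ext x
        simp
      map_smul' := fun c p => by
        rw [RingHom.id_apply, ← MemLp.toLp_const_smul]
        congr 1
        ext x
        simp [MvPolynomial.smul_eval] }
  -- Injectivity makes evaluation on `S` a linear map on the range of `T`. That range is finite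
  -- dimensional, so the map is bounded, and its norm serves as the constant.
  have hT : Function.Injective T := by
    rw [← LinearMap.ker_eq_bot, LinearMap.ker_eq_bot']
    intro p hp
    have h0 : (hL p.1).toLp _ = 0 := hp
    have h0' := (hL p.1).coeFn_toLp.symm
    rw [h0] at h0'
    have h1 := Measure.eqOn_open_of_ae_eq (h0'.trans (Lp.coeFn_zero _ _ _)) hU (hc p.1).continuousOn continuousOn_const
    exact Subtype.ext (eq_zero_of_eval_eq_zero hU hne p.1 h1)
  have : CompactSpace S := isCompact_iff_compactSpace.1 hS
  let ψ : V →ₗ[ℝ] C(S, ℝ) :=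
    { toFun := fun p => ⟨fun x => MvPolynomial.eval (fun b => x.1 b) p.1,
        (hc p.1).comp continuous_subtype_val⟩
      map_add' := fun p q => by ext x; simp
      map_smul' := fun c p => by ext x; simp [MvPolynomial.smul_eval] }
  let e := LinearEquiv.ofInjective T hT
  let Λ : LinearMap.range T →L[ℝ] C(S, ℝ) :=
    LinearMap.toContinuousLinearMap (ψ ∘ₗ e.symm.toLinearMap)
  refine ⟨‖Λ‖, Λ.opNorm_nonneg, ?_⟩
  rintro f ⟨p, hp, hpf⟩ x hx
  let p' : V := ⟨p, (MvPolynomial.mem_restrictTotalDegree _ _ _).2 hp⟩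
  have h1 : ‖T p'‖ = Real.sqrt (∫ x in U, f x ^ 2) := by
    change ‖(hL p).toLp _‖ = _
    rw [Lp.norm_toLp, MemLp.eLpNorm_eq_integral_rpow_norm (by simp) (by simp) (hL p),
      ENNReal.toReal_ofReal (by positivity), Real.sqrt_eq_rpow]
    simp [hpf]
  have h2 : ψ p' = Λ (e p') := by simp [Λ]
  calc |f x| = ‖ψ p' ⟨x, hx⟩‖ := by rw [hpf]; rfl
    _ ≤ ‖ψ p'‖ := ContinuousMap.norm_coe_le_norm _ _
    _ ≤ ‖Λ‖ * ‖e p'‖ := h2 ▸ Λ.le_opNorm _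
    _ = ‖Λ‖ * Real.sqrt (∫ x in U, f x ^ 2) := by rw [← h1]; rfl


/-! ### Geometry of the reference triangle -/

theorem refBary_nonneg {x : Plane} (hx : x ∈ refTriangle) (k : Fin 3) : 0 ≤ refBary k x := by
  have hconv : Convex ℝ {y : Plane | 0 ≤ refBary k y} := by
    intro y hy z hz a b ha hb hab
    simp only [mem_ofPred_eq] at hy hz ⊢
    have : refBary k (a • y + b • z) = a * refBary k y + b * refBary k z := by
      obtain rfl : b = 1 - a := by linarith
      fin_cases k <;> simp [refBary] <;> ring
    rw [this]
    positivity
  refine convexHull_min ?_ hconv hx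
  rintro _ ⟨j, rfl⟩
  fin_cases k <;> fin_cases j <;> simp [refBary, refVertex]

theorem sum_refBary_smul (x : Plane) : ∑ k, refBary k x • refVertex k = x := by
  ext b
  fin_cases b <;> simp [Fin.sum_univ_three, refBary, refVertex]

/-- Cell `k` is the region where the barycentric coordinate `k` is the smallest. The weights with
respect to its own vertices are `3 λ_k`, `λ_{k+1} - λ_k` and `λ_{k+2} - λ_k`. -/
theorem mem_refCell {k : Fin 3} {x : Plane} (h0 : 0 ≤ refBary k x)
    (h1 : refBary k x ≤ refBary (k + 1) x) (h2 : refBary k x ≤ refBary (k + 2) x) :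
    x ∈ refCell k := by
  have hs : 3 * refBary k x + (refBary (k + 1) x - refBary k x) +
      (refBary (k + 2) x - refBary k x) = 1 := by
    fin_cases k <;> simp [refBary] <;> ring
  have hx : x = (3 * refBary k x) • refCenter +
      (refBary (k + 1) x - refBary k x) • refVertex (k + 1) +
      (refBary (k + 2) x - refBary k x) • refVertex (k + 2) := by
    ext b
    fin_cases k <;> fin_cases b <;> simp [refBary, refVertex, refCenter] <;> ring
  have hsub := subset_convexHull ℝ {refCenter, refVertex (k + 1), refVertex (k + 2)}
  have := (convex_convexHull ℝ {refCenter, refVertex (k + 1), refVertex (k + 2)}).sum_mem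
    (t := Finset.univ) (w := ![3 * refBary k x, refBary (k + 1) x - refBary k x,
      refBary (k + 2) x - refBary k x])
    (z := ![refCenter, refVertex (k + 1), refVertex (k + 2)])
    (by simp [Fin.forall_fin_succ, h0, h1, h2]) (by simpa [Fin.sum_univ_three] using hs)
    (fun i _ => by fin_cases i <;> exact hsub (by simp))
  rw [hx, refCell]
  simpa only [Fin.sum_univ_three, Matrix.cons_val_zero, Matrix.cons_val_one,
    Matrix.cons_val] using this

theorem mem_refTriangle {x : Plane} (h : ∀ k, 0 ≤ refBary k x) : x ∈ refTriangle := by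
  rw [← sum_refBary_smul x]
  refine (convex_convexHull ℝ _).sum_mem (fun k _ => h k) ?_
    fun k _ => subset_convexHull ℝ _ (mem_range_self k)
  simp [Fin.sum_univ_three, refBary]
  ring

theorem refCenter_mem : refCenter ∈ refTriangle :=
  mem_refTriangle fun k => by fin_cases k <;> simp [refBary, refCenter] <;> norm_num

theorem refVertex_mem (k : Fin 3) : refVertex k ∈ refTriangle :=
  subset_convexHull ℝ _ (mem_range_self k)

theorem refCell_subset (k : Fin 3) : refCell k ⊆ refTriangle := by
  refine convexHull_min ?_ (convex_convexHull ℝ _)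
  rintro x (rfl | rfl | rfl)
  exacts [refCenter_mem, refVertex_mem _, refVertex_mem _]

theorem refTriangle_subset : refTriangle ⊆ ⋃ k, refCell k := by
  intro x hx
  obtain ⟨k, -, hk⟩ := Finset.exists_min_image Finset.univ (fun k => refBary k x)
    Finset.univ_nonempty
  exact mem_iUnion.2 ⟨k, mem_refCell (refBary_nonneg hx k) (hk _ (Finset.mem_univ _))
    (hk _ (Finset.mem_univ _))⟩

theorem continuous_refBary (k : Fin 3) : Continuous (refBary k) := by
  fin_cases k <;> unfold refBary <;> simp <;> fun_prop

theorem nonempty_interior_refCell (k : Fin 3) : (interior (refCell k)).Nonempty := by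
  have hopen : IsOpen {x : Plane | 0 < refBary k x ∧ refBary k x < refBary (k + 1) x ∧
      refBary k x < refBary (k + 2) x} := by
    have hc := continuous_refBary
    exact (isOpen_lt continuous_const (hc _)).inter
      ((isOpen_lt (hc _) (hc _)).inter (isOpen_lt (hc _) (hc _)))
  have hsub : {x : Plane | 0 < refBary k x ∧ refBary k x < refBary (k + 1) x ∧
      refBary k x < refBary (k + 2) x} ⊆ refCell k :=
    fun x hx => mem_refCell hx.1.le hx.2.1.le hx.2.2.le
  -- The barycentric coordinates `1/5`, `2/5`, `2/5` satisfy the strict form of the inequalities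
  -- that describe the cell.
  refine Nonempty.mono (interior_maximal hsub hopen)
    ⟨(1 / 5 : ℝ) • refVertex k + (2 / 5 : ℝ) • refVertex (k + 1) +
      (2 / 5 : ℝ) • refVertex (k + 2), ?_⟩
  fin_cases k <;> simp [refBary, refVertex] <;> norm_num

/-- The point with parameter `t` on edge number `k` of the reference triangle. -/
def refEdge (k : Fin 3) (t : ℝ) : Plane :=
  AffineMap.lineMap (refVertex (k + 1)) (refVertex (k + 2)) t

theorem refEdge_mem_refCell (k : Fin 3) {t : ℝ} (ht : t ∈ Icc (0 : ℝ) 1) :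
    refEdge k t ∈ refCell k := by
  have hsub := subset_convexHull ℝ {refCenter, refVertex (k + 1), refVertex (k + 2)}
  have := (convex_convexHull ℝ _).segment_subset (hsub (a := refVertex (k + 1)) (by simp))
    (hsub (a := refVertex (k + 2)) (by simp))
  rw [segment_eq_image_lineMap] at this
  exact this ⟨t, ht, rfl⟩

theorem refEdge_mem (k : Fin 3) {t : ℝ} (ht : t ∈ Icc (0 : ℝ) 1) : refEdge k t ∈ refTriangle :=
  refCell_subset k (refEdge_mem_refCell k ht)

theorem refEdge_zero (k : Fin 3) : refEdge k 0 = refVertex (k + 1) := by simp [refEdge]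

theorem refEdge_one (k : Fin 3) : refEdge k 1 = refVertex (k + 2) := by simp [refEdge]

theorem refEdge_half (k : Fin 3) :
    refEdge k (1 / 2) = midpoint ℝ (refVertex (k + 1)) (refVertex (k + 2)) := by
  simp [refEdge, midpoint]

theorem refEdge_mem_refNodes (k : Fin 3) {t : ℝ} (ht : t = 0 ∨ t = 1 / 2 ∨ t = 1) :
    refEdge k t ∈ refNodes := by
  rcases ht with rfl | rfl | rfl
  · exact Or.inl (Or.inl (Or.inl ⟨_, (refEdge_zero k).symm⟩))
  · exact Or.inl (Or.inr ⟨k, (refEdge_half k).symm⟩)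
  · exact Or.inl (Or.inl (Or.inl ⟨_, (refEdge_one k).symm⟩))

theorem isCompact_refTriangle : IsCompact refTriangle :=
  (finite_range _).isCompact_convexHull ℝ

theorem isCompact_refCell (k : Fin 3) : IsCompact (refCell k) :=
  Set.Finite.isCompact_convexHull ℝ (toFinite _)

/-! ### Simpson's rule -/

/-- The error of Simpson's rule on the unit interval. -/
def simpsonError (f : ℝ → ℝ) : ℝ :=
  (∫ t in (0 : ℝ)..1, f t) - (f 0 + 4 * f (1 / 2) + f 1) / 6

theorem simpsonError_congr {f g : ℝ → ℝ} (h : EqOn f g (Icc 0 1)) :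
    simpsonError f = simpsonError g := by
  have : ∫ t in (0 : ℝ)..1, f t = ∫ t in (0 : ℝ)..1, g t :=
    intervalIntegral.integral_congr (by rwa [uIcc_of_le zero_le_one])
  rw [simpsonError, simpsonError, this, h (by norm_num), h (by norm_num : (1 / 2 : ℝ) ∈ _),
    h (by norm_num)]

theorem simpsonError_add {f g : ℝ → ℝ} (hf : ContinuousOn f (Icc 0 1))
    (hg : ContinuousOn g (Icc 0 1)) :
    simpsonError (fun t => f t + g t) = simpsonError f + simpsonError g := by
  rw [simpsonError, intervalIntegral.integral_add
    (hf.intervalIntegrable_of_Icc zero_le_one) (hg.intervalIntegrable_of_Icc zero_le_one)]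
  simp only [simpsonError]
  ring

theorem abs_simpsonError_le {f : ℝ → ℝ} {B : ℝ} (h : ∀ t ∈ Icc (0 : ℝ) 1, |f t| ≤ B) :
    |simpsonError f| ≤ 2 * B := by
  have h1 : |∫ t in (0 : ℝ)..1, f t| ≤ B := by
    have := intervalIntegral.norm_integral_le_of_norm_le_const (a := 0) (b := 1) (f := f) (C := B)
      fun t ht => h t (by rw [uIoc_of_le zero_le_one] at ht; exact Ioc_subset_Icc_self ht)
    simpa using this
  have h2 := h 0 (by norm_num)
  have h3 := h (1 / 2) (by norm_num)
  have h4 := h 1 (by norm_num)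
  rw [simpsonError]
  rw [abs_le] at *
  constructor <;> linarith

/-- Simpson's rule is exact on cubic polynomials. -/
theorem simpsonError_polynomial {P : Polynomial ℝ} (hP : P.natDegree ≤ 3) :
    simpsonError (fun t => P.eval t) = 0 := by
  have : ∀ t, P.eval t = P.coeff 0 + P.coeff 1 * t ^ 1 + P.coeff 2 * t ^ 2 + P.coeff 3 * t ^ 3 := by
    intro t
    rw [Polynomial.eval_eq_sum_range' (Nat.lt_succ_of_le hP)]
    simp [Finset.sum_range_succ]
  simp only [simpsonError, this]
  rw [intervalIntegral.integral_add, intervalIntegral.integral_add, intervalIntegral.integral_add]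
  · simp only [intervalIntegral.integral_const_mul, integral_pow,
      intervalIntegral.integral_const, smul_eq_mul]
    norm_num
    ring
  all_goals exact Continuous.intervalIntegrable (by fun_prop) _ _

theorem simpsonError_reflect (f : ℝ → ℝ) :
    simpsonError (fun t => f (1 - t)) = simpsonError f := by
  rw [simpsonError, simpsonError, intervalIntegral.integral_comp_sub_left]
  norm_num
  ring

/-! ### Quotients by the Jacobian determinant along an edge -/

/-- An affine function divided by a quadratic one is affine up to a remainder of relative order
two. -/
theorem affine_div_quadratic {d₀ d₁ d₂ a s t : ℝ} (h0 : d₀ ≠ 0)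
    (hq : d₀ + d₁ * t + d₂ * t ^ 2 ≠ 0) :
    (a + t * s) / (d₀ + d₁ * t + d₂ * t ^ 2) = (a / d₀ + t * (s / d₀ - a * d₁ / d₀ ^ 2)) +
      (-(s * d₁ / d₀ ^ 2) * t ^ 2 + (a + t * s) * (t ^ 2 * (-d₂ * d₀ + d₁ ^ 2 + d₁ * d₂ * t) /
        (d₀ ^ 2 * (d₀ + d₁ * t + d₂ * t ^ 2)))) := by
  generalize hQ : d₀ + d₁ * t + d₂ * t ^ 2 = q at hq
  have : d₀ ^ 2 * (a + t * s) = q * d₀ ^ 2 * ((a / d₀ + t * (s / d₀ - a * d₁ / d₀ ^ 2)) +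
      -(s * d₁ / d₀ ^ 2) * t ^ 2) +
      (a + t * s) * (t ^ 2 * (-d₂ * d₀ + d₁ ^ 2 + d₁ * d₂ * t)) := by
    field_simp
    rw [← hQ]
    ring
  field_simp at this ⊢
  linear_combination this

/-- In the application `d₀ + d₁ t + d₂ t²` is the Jacobian determinant and `a + t s` an entry of
`DF` along an edge. Two bounds for `d₁` are assumed so that every term of the numerator is of order
exactly `h ^ 6`, matching the denominator; no upper bound on `h` is then needed. -/
theorem abs_affine_div_quadratic_remainder_le {d₀ d₁ d₂ a s t h K : ℝ} (hh : 0 < h) (hK : 0 < K)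
    (ht : t ∈ Icc (0 : ℝ) 1) (h0 : h ^ 2 ≤ K * |d₀|) (h0' : |d₀| ≤ 2 * K ^ 2 * h ^ 2)
    (hq : h ^ 2 ≤ K * |d₀ + d₁ * t + d₂ * t ^ 2|)
    (h1 : |d₁| ≤ 4 * K ^ 2 * h ^ 3) (h1' : |d₁| ≤ 8 * K ^ 2 * h ^ 2) (h2 : |d₂| ≤ 2 * K ^ 2 * h ^ 4)
    (ha : |a + t * s| ≤ K * h) (hs : |s| ≤ K * h ^ 2) :
    |-(s * d₁ / d₀ ^ 2) * t ^ 2 + (a + t * s) * (t ^ 2 * (-d₂ * d₀ + d₁ ^ 2 + d₁ * d₂ * t) /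
        (d₀ ^ 2 * (d₀ + d₁ * t + d₂ * t ^ 2)))| ≤ (4 * K ^ 5 + 36 * K ^ 8) * h := by
  set q := d₀ + d₁ * t + d₂ * t ^ 2
  have htt : |t| ≤ 1 := abs_le.2 ⟨by linarith [ht.1], ht.2⟩
  have htt2 : |t ^ 2| ≤ 1 := by rw [abs_pow]; exact pow_le_one₀ (abs_nonneg _) htt
  have hd0 : 0 < |d₀| := by
    by_contra hc
    nlinarith [pow_pos hh 2, abs_nonneg d₀]
  have hdq : 0 < |q| := by
    by_contra hc
    nlinarith [pow_pos hh 2, abs_nonneg q]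
  have hd4 : h ^ 4 ≤ K ^ 2 * |d₀| ^ 2 := by
    calc h ^ 4 = (h ^ 2) ^ 2 := by ring
      _ ≤ (K * |d₀|) ^ 2 := by gcongr
      _ = _ := by ring
  have hd6 : h ^ 6 ≤ K ^ 3 * (|d₀| ^ 2 * |q|) := by
    calc h ^ 6 = h ^ 4 * h ^ 2 := by ring
      _ ≤ (K ^ 2 * |d₀| ^ 2) * (K * |q|) := by gcongr
      _ = _ := by ring
  have e1 : |-(s * d₁ / d₀ ^ 2) * t ^ 2| ≤ 4 * K ^ 5 * h := by
    rw [abs_mul, abs_neg, abs_div, abs_mul, abs_pow d₀]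
    have : |s| * |d₁| / |d₀| ^ 2 ≤ 4 * K ^ 5 * h := by
      rw [div_le_iff₀ (by positivity)]
      calc |s| * |d₁| ≤ (K * h ^ 2) * (4 * K ^ 2 * h ^ 3) := by gcongr
        _ = 4 * K ^ 3 * h * h ^ 4 := by ring
        _ ≤ 4 * K ^ 3 * h * (K ^ 2 * |d₀| ^ 2) := by gcongr
        _ = _ := by ring
    calc _ ≤ (4 * K ^ 5 * h) * 1 := by gcongr
      _ = _ := by ring
  have e2 : |t ^ 2 * (-d₂ * d₀ + d₁ ^ 2 + d₁ * d₂ * t) / (d₀ ^ 2 * q)| ≤ 36 * K ^ 7 := by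
    rw [abs_div, abs_mul, abs_mul (d₀ ^ 2), abs_pow d₀, div_le_iff₀ (by positivity)]
    -- The square of `d₁` uses the bound of order `h ^ 3`, the product `d₁ d₂` the one of order `h ^
    -- 2`; the constant is `36 = 4 + 16 + 16`.
    have : |-d₂ * d₀ + d₁ ^ 2 + d₁ * d₂ * t| ≤ 36 * K ^ 4 * h ^ 6 := by
      calc _ ≤ |-d₂ * d₀| + |d₁ ^ 2| + |d₁ * d₂ * t| := abs_add_three _ _ _
        _ = |d₂| * |d₀| + |d₁| ^ 2 + |d₁| * |d₂| * |t| := by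
          simp only [abs_mul, abs_neg, abs_pow]
        _ ≤ (2 * K ^ 2 * h ^ 4) * (2 * K ^ 2 * h ^ 2) + (4 * K ^ 2 * h ^ 3) ^ 2 +
            (8 * K ^ 2 * h ^ 2) * (2 * K ^ 2 * h ^ 4) * 1 := by gcongr
        _ = _ := by ring
    calc _ ≤ 1 * (36 * K ^ 4 * h ^ 6) := by gcongr
      _ = 36 * K ^ 4 * h ^ 6 := by ring
      _ ≤ 36 * K ^ 4 * (K ^ 3 * (|d₀| ^ 2 * |q|)) := by gcongr
      _ = _ := by ring
  calc _ ≤ _ + _ := abs_add_le _ _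
    _ ≤ 4 * K ^ 5 * h + (K * h) * (36 * K ^ 7) := by
      rw [abs_mul (a + t * s)]
      gcongr
    _ = _ := by ring


/-! ### Jacobian matrices -/

/-- The entry `∂_b F_a` of the Jacobian matrix of `F`. -/
def jac (F : Plane → Plane) (a b : Fin 2) (x : Plane) : ℝ :=
  fderiv ℝ F x (EuclideanSpace.single b 1) a

/-- The Jacobian determinant of `F`. -/
def jacDet (F : Plane → Plane) (x : Plane) : ℝ :=
  jac F 0 0 x * jac F 1 1 x - jac F 0 1 x * jac F 1 0 x

theorem eq_sum_single (w : Plane) : w = ∑ b, w b • EuclideanSpace.single b (1 : ℝ) := by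
  ext a
  fin_cases a <;> simp [Fin.sum_univ_two]

theorem clm_apply_eq_sum (L : Plane →L[ℝ] Plane) (w : Plane) (a : Fin 2) :
    L w a = ∑ b, L (EuclideanSpace.single b 1) a * w b := by
  conv_lhs => rw [eq_sum_single w]
  rw [Fin.sum_univ_two, Fin.sum_univ_two, map_add, map_smul, map_smul]
  simp only [PiLp.add_apply, PiLp.smul_apply, smul_eq_mul]
  ring

theorem clm_det_eq (L : Plane →L[ℝ] Plane) :
    L.det = L (EuclideanSpace.single 0 1) 0 * L (EuclideanSpace.single 1 1) 1 -
      L (EuclideanSpace.single 1 1) 0 * L (EuclideanSpace.single 0 1) 1 := by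
  rw [ContinuousLinearMap.det,
    ← LinearMap.det_toMatrix (EuclideanSpace.basisFun (Fin 2) ℝ).toBasis, Matrix.det_fin_two]
  simp [LinearMap.toMatrix_apply]

theorem det_fderiv_eq (F : Plane → Plane) (x : Plane) : (fderiv ℝ F x).det = jacDet F x :=
  clm_det_eq _

theorem fderiv_apply_eq_sum (F : Plane → Plane) (x w : Plane) (a : Fin 2) :
    fderiv ℝ F x w a = ∑ b, jac F a b x * w b :=
  clm_apply_eq_sum _ w a

theorem gradSq_eq (v : Plane → Plane) (x : Plane) :
    gradSq v x = jac v 0 0 x ^ 2 + jac v 0 1 x ^ 2 + (jac v 1 0 x ^ 2 + jac v 1 1 x ^ 2) := by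
  simp [gradSq, Fin.sum_univ_two, jac]

theorem gradSq_nonneg (v : Plane → Plane) (x : Plane) : 0 ≤ gradSq v x := by
  rw [gradSq_eq]
  positivity

theorem partialDeriv_div {f g : Plane → ℝ} {x : Plane} (hf : DifferentiableAt ℝ f x)
    (hg : DifferentiableAt ℝ g x) (h0 : g x ≠ 0) (b : Fin 2) :
    partialDeriv b (fun x => f x / g x) x =
      (g x * partialDeriv b f x - f x * partialDeriv b g x) / g x ^ 2 := by
  have h := hf.hasFDerivAt.mul ((hasDerivAt_inv h0).comp_hasFDerivAt x hg.hasFDerivAt)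
  have h' : HasFDerivAt (fun x => f x / g x) _ x := h.congr_of_eventuallyEq
    (Filter.Eventually.of_forall fun y => by simp [div_eq_mul_inv])
  rw [partialDeriv, h'.fderiv]
  simp [partialDeriv]
  field_simp
  ring

/-- If `v ∘ F` agrees near `x` with a differentiable field and `DF` is invertible at `x`,
then `v` is differentiable at `F x`. -/
theorem differentiableAt_of_comp {F v Y : Plane → Plane} {x : Plane} (hF : ContDiff ℝ 2 F)
    (hdet : jacDet F x ≠ 0) (hY : DifferentiableAt ℝ Y x) (h : ∀ᶠ y in nhds x, v (F y) = Y y) :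
    DifferentiableAt ℝ v (F x) := by
  rw [← det_fderiv_eq] at hdet
  have hs : HasStrictFDerivAt F
      ((fderiv ℝ F x).toContinuousLinearEquivOfDetNeZero hdet : Plane →L[ℝ] Plane) x := by
    rw [ContinuousLinearMap.coe_toContinuousLinearEquivOfDetNeZero]
    exact hF.contDiffAt.hasStrictFDerivAt (by norm_num)
  have hg := hs.to_localInverse.hasFDerivAt.differentiableAt
  have hY' : DifferentiableAt ℝ Y (hs.localInverse F _ x (F x)) := by
    rwa [hs.localInverse_apply_image]
  refine (hY'.comp (F x) hg).congr_of_eventuallyEq ?_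
  -- Near `F x`, the field `v` is `Y` composed with the local inverse of `F`.
  have h1 := hs.localInverse_tendsto.eventually h
  filter_upwards [hs.eventually_right_inverse, h1] with y hy hy'
  rw [Function.comp_apply, ← hy', hy]

theorem partialDeriv_comp {F v : Plane → Plane} {x : Plane} (hF : DifferentiableAt ℝ F x)
    (hv : DifferentiableAt ℝ v (F x)) (a b : Fin 2) :
    partialDeriv b (fun y => v (F y) a) x = ∑ c, jac v a c (F x) * jac F c b x := by
  have h := (EuclideanSpace.proj a : Plane →L[ℝ] ℝ).hasFDerivAt.comp x
    (hv.hasFDerivAt.comp x hF.hasFDerivAt)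
  have h' : HasFDerivAt (fun y => v (F y) a) _ x := h
  rw [partialDeriv, h'.fderiv]
  simp only [ContinuousLinearMap.comp_apply, PiLp.proj_apply]
  rw [fderiv_apply_eq_sum]
  rfl

/-! ### The Piola transform of a quadratic field -/

/-- Bounds for a quadratic chart `F` of size `h` on the reference triangle. -/
structure IsQuadChart (K h : ℝ) (F : Plane → Plane) : Prop where
  contDiff : ContDiff ℝ 2 F
  isPoly : ∀ a b, IsPolyFun 1 (jac F a b)
  bound : ∀ x ∈ refTriangle, ∀ a b, |jac F a b x| ≤ K * h
  det_bound : ∀ x ∈ refTriangle, h ^ 2 ≤ K * |jacDet F x|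
  osc : ∀ x ∈ refTriangle, ∀ y ∈ refTriangle, ∀ a b, |jac F a b y - jac F a b x| ≤ K * h ^ 2
  injOn : InjOn F refTriangle

/-- The components of `DF z`. -/
def piolaNum (F : Plane → Plane) (z : Fin 2 → Plane → ℝ) (a : Fin 2) (x : Plane) : ℝ :=
  jac F a 0 x * z 0 x + jac F a 1 x * z 1 x

/-- The components of the Piola transform `DF z / det DF`. -/
def piola (F : Plane → Plane) (z : Fin 2 → Plane → ℝ) (a : Fin 2) (x : Plane) : ℝ :=
  piolaNum F z a x / jacDet F x

/-- The numerator of the partial derivatives of the Piola transform. -/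
def piolaGrad (F : Plane → Plane) (z : Fin 2 → Plane → ℝ) (a b : Fin 2) (x : Plane) : ℝ :=
  jacDet F x * partialDeriv b (piolaNum F z a) x - piolaNum F z a x * partialDeriv b (jacDet F) x

namespace IsQuadChart

variable {K h : ℝ} {F : Plane → Plane}

theorem jacDet_ne_zero (hF : IsQuadChart K h F) (hh : 0 < h) {x : Plane} (hx : x ∈ refTriangle) :
    jacDet F x ≠ 0 := by
  intro h0
  have := hF.det_bound x hx
  rw [h0, abs_zero, mul_zero] at this
  nlinarith

theorem abs_jacDet_le (hF : IsQuadChart K h F) {x : Plane} (hx : x ∈ refTriangle) :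
    |jacDet F x| ≤ 2 * K ^ 2 * h ^ 2 := by
  have hb := hF.bound x hx
  have hKh : 0 ≤ K * h := (abs_nonneg _).trans (hb 0 0)
  calc |jacDet F x| ≤ |jac F 0 0 x * jac F 1 1 x| + |jac F 0 1 x * jac F 1 0 x| := abs_sub _ _
    _ ≤ (K * h) * (K * h) + (K * h) * (K * h) := by
      rw [abs_mul, abs_mul]
      gcongr <;> exact hb _ _
    _ = _ := by ring

theorem isPoly_jacDet (hF : IsQuadChart K h F) : IsPolyFun 2 (jacDet F) :=
  ((hF.isPoly 0 0).mul (hF.isPoly 1 1)).sub ((hF.isPoly 0 1).mul (hF.isPoly 1 0))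

theorem isPoly_piolaNum (hF : IsQuadChart K h F) {z : Fin 2 → Plane → ℝ}
    (hz : ∀ a, IsPolyFun 2 (z a)) (a : Fin 2) : IsPolyFun 3 (piolaNum F z a) :=
  ((hF.isPoly a 0).mul (hz 0)).add ((hF.isPoly a 1).mul (hz 1))

theorem isPoly_piolaGrad (hF : IsQuadChart K h F) {z : Fin 2 → Plane → ℝ}
    (hz : ∀ a, IsPolyFun 2 (z a)) (a b : Fin 2) : IsPolyFun 5 (piolaGrad F z a b) :=
  (hF.isPoly_jacDet.mul ((hF.isPoly_piolaNum hz a).partialDeriv b)).sub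
    ((hF.isPoly_piolaNum hz a).mul (hF.isPoly_jacDet.partialDeriv b))

theorem differentiableAt_piola (hF : IsQuadChart K h F) {z : Fin 2 → Plane → ℝ}
    (hz : ∀ a, IsPolyFun 2 (z a)) (hh : 0 < h) {x : Plane} (hx : x ∈ refTriangle) (a : Fin 2) :
    DifferentiableAt ℝ (piola F z a) x := by
  have h1 := ((hF.isPoly_piolaNum hz a).differentiable x)
  have h2 := (hF.isPoly_jacDet.differentiable x)
  have h := h1.hasFDerivAt.mul
    ((hasDerivAt_inv (hF.jacDet_ne_zero hh hx)).comp_hasFDerivAt x h2.hasFDerivAt)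
  exact (h.congr_of_eventuallyEq (Filter.Eventually.of_forall fun y => by
    simp [piola, div_eq_mul_inv])).differentiableAt

theorem partialDeriv_piola (hF : IsQuadChart K h F) {z : Fin 2 → Plane → ℝ}
    (hz : ∀ a, IsPolyFun 2 (z a)) (hh : 0 < h) {x : Plane} (hx : x ∈ refTriangle) (a b : Fin 2) :
    partialDeriv b (piola F z a) x = piolaGrad F z a b x / jacDet F x ^ 2 :=
  partialDeriv_div ((hF.isPoly_piolaNum hz a).differentiable x)
    (hF.isPoly_jacDet.differentiable x) (hF.jacDet_ne_zero hh hx) b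

/-- The chain rule for the Piola transform, at interior points of a cell of the split. -/
theorem piolaGrad_eq (hF : IsQuadChart K h F) {z : Fin 2 → Plane → ℝ}
    (hz : ∀ a, IsPolyFun 2 (z a)) (hh : 0 < h) {v : Plane → Plane} {k : Fin 3}
    (hv : ∀ x ∈ refCell k, ∀ a, v (F x) a = piola F z a x) {x : Plane}
    (hx : x ∈ interior (refCell k)) (a b : Fin 2) :
    piolaGrad F z a b x / jacDet F x ^ 2 =
      jac v a 0 (F x) * jac F 0 b x + jac v a 1 (F x) * jac F 1 b x := by
  have hxT := refCell_subset k (interior_subset hx)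
  have hnear : ∀ᶠ y in nhds x, y ∈ refCell k :=
    Filter.mem_of_superset (isOpen_interior.mem_nhds hx) interior_subset
  have hY : DifferentiableAt ℝ (fun y => WithLp.toLp 2 fun a => piola F z a y : Plane → Plane) x := by
    rw [differentiableAt_piLp]
    exact fun a => hF.differentiableAt_piola hz hh hxT a
  have hdv : DifferentiableAt ℝ v (F x) :=
    differentiableAt_of_comp hF.contDiff (hF.jacDet_ne_zero hh hxT) hY
      (hnear.mono fun y hy => by ext a; simp [hv y hy])
  have hcomp := partialDeriv_comp (hF.contDiff.differentiable (by norm_num) x) hdv a b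
  rw [Fin.sum_univ_two] at hcomp
  rw [← hcomp, ← hF.partialDeriv_piola hz hh hxT, partialDeriv, partialDeriv]
  congr 1
  exact Filter.EventuallyEq.fderiv_eq (hnear.mono fun y hy => (hv y hy a).symm)

/-- By the chain rule `piolaGrad` is `(det DF)²` times an entry of `∇v DF`. Bounding `(det DF)⁴` and
a column of `DF` gives a power `h ^ 10`; one factor `h ^ 2` is traded for `K |det DF|`, the density
in the change of variables. -/
theorem piolaGrad_sq_le (hF : IsQuadChart K h F) {z : Fin 2 → Plane → ℝ}
    (hz : ∀ a, IsPolyFun 2 (z a)) (hh : 0 < h) {v : Plane → Plane} {k : Fin 3}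
    (hv : ∀ x ∈ refCell k, ∀ a, v (F x) a = piola F z a x) {x : Plane}
    (hx : x ∈ interior (refCell k)) (a b : Fin 2) :
    piolaGrad F z a b x ^ 2 ≤
      (32 * K ^ 11 * h ^ 8) * (|jacDet F x| * gradSq v (F x)) := by
  have hxT := refCell_subset k (interior_subset hx)
  have hq := hF.jacDet_ne_zero hh hxT
  have h1 := hF.piolaGrad_eq hz hh hv hx a b
  have h2 : piolaGrad F z a b x = jacDet F x ^ 2 *
      (jac v a 0 (F x) * jac F 0 b x + jac v a 1 (F x) * jac F 1 b x) := by
    rw [← h1]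
    field_simp
  have h3 : jac v a 0 (F x) ^ 2 + jac v a 1 (F x) ^ 2 ≤ gradSq v (F x) := by
    rw [gradSq_eq]
    fin_cases a
    · simp only [Fin.zero_eta]; nlinarith [sq_nonneg (jac v 1 0 (F x)), sq_nonneg (jac v 1 1 (F x))]
    · simp only [Fin.mk_one]; nlinarith [sq_nonneg (jac v 0 0 (F x)), sq_nonneg (jac v 0 1 (F x))]
  have h4 : jac F 0 b x ^ 2 + jac F 1 b x ^ 2 ≤ 2 * K ^ 2 * h ^ 2 := by
    have e0 := pow_le_pow_left₀ (abs_nonneg _) (hF.bound x hxT 0 b) 2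
    have e1 := pow_le_pow_left₀ (abs_nonneg _) (hF.bound x hxT 1 b) 2
    rw [sq_abs] at e0 e1
    nlinarith
  have hG := gradSq_nonneg v (F x)
  have h5 : (jac v a 0 (F x) * jac F 0 b x + jac v a 1 (F x) * jac F 1 b x) ^ 2 ≤
      gradSq v (F x) * (2 * K ^ 2 * h ^ 2) :=
    calc
      _ ≤ (jac v a 0 (F x) ^ 2 + jac v a 1 (F x) ^ 2) *
          (jac F 0 b x ^ 2 + jac F 1 b x ^ 2) := by
        nlinarith [sq_nonneg (jac v a 0 (F x) * jac F 1 b x - jac v a 1 (F x) * jac F 0 b x)]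
      _ ≤ _ := by gcongr
  have hdb := hF.det_bound x hxT
  have hK : 0 ≤ K := by
    by_contra hc
    nlinarith [abs_nonneg (jacDet F x), pow_pos hh 2]
  have hd := hF.abs_jacDet_le hxT
  calc piolaGrad F z a b x ^ 2 = |jacDet F x| ^ 4 *
        (jac v a 0 (F x) * jac F 0 b x + jac v a 1 (F x) * jac F 1 b x) ^ 2 := by
        rw [h2, mul_pow, ← sq_abs (jacDet F x)]
        ring
    _ ≤ (2 * K ^ 2 * h ^ 2) ^ 4 * (gradSq v (F x) * (2 * K ^ 2 * h ^ 2)) := by gcongr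
    _ = 32 * K ^ 10 * h ^ 8 * (gradSq v (F x) * h ^ 2) := by ring
    _ ≤ 32 * K ^ 10 * h ^ 8 * (gradSq v (F x) * (K * |jacDet F x|)) := by gcongr
    _ = _ := by ring

variable {z : Fin 2 → Plane → ℝ} {v : Plane → Plane} {k : Fin 3}

theorem hasFDerivWithinAt (hF : IsQuadChart K h F) (s : Set Plane) :
    ∀ x ∈ s, HasFDerivWithinAt F (fderiv ℝ F x) s x := fun x _ =>
  (hF.contDiff.differentiable (by norm_num) x).hasFDerivAt.hasFDerivWithinAt

theorem injOn_interior (hF : IsQuadChart K h F) (k : Fin 3) : InjOn F (interior (refCell k)) :=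
  hF.injOn.mono (interior_subset.trans (refCell_subset k))

/-- The gradient of `v` at image points of a cell, in terms of the Piola transform. -/
theorem jac_comp_eq (hF : IsQuadChart K h F) (hz : ∀ a, IsPolyFun 2 (z a)) (hh : 0 < h)
    (hv : ∀ x ∈ refCell k, ∀ a, v (F x) a = piola F z a x) {x : Plane}
    (hx : x ∈ interior (refCell k)) (a : Fin 2) :
    jac v a 0 (F x) = (piolaGrad F z a 0 x * jac F 1 1 x - piolaGrad F z a 1 x * jac F 1 0 x) /
        jacDet F x ^ 3 ∧
      jac v a 1 (F x) = (piolaGrad F z a 1 x * jac F 0 0 x - piolaGrad F z a 0 x * jac F 0 1 x) /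
        jacDet F x ^ 3 := by
  have hq := hF.jacDet_ne_zero hh (refCell_subset k (interior_subset hx))
  have h0 := hF.piolaGrad_eq hz hh hv hx a 0
  have h1 := hF.piolaGrad_eq hz hh hv hx a 1
  rw [div_eq_iff (pow_ne_zero 2 hq)] at h0 h1
  constructor
  · rw [eq_div_iff (pow_ne_zero 3 hq), h0, h1, jacDet]
    ring
  · rw [eq_div_iff (pow_ne_zero 3 hq), h0, h1, jacDet]
    ring

/-- By `jac_comp_eq` the integrand agrees on the open cell with a function continuous on the compact
closed cell. -/
theorem integrableOn_jacDet_mul_gradSq (hF : IsQuadChart K h F) (hz : ∀ a, IsPolyFun 2 (z a))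
    (hh : 0 < h) (hv : ∀ x ∈ refCell k, ∀ a, v (F x) a = piola F z a x) :
    IntegrableOn (fun x => |jacDet F x| * gradSq v (F x)) (interior (refCell k)) := by
  have hJ := fun a b => (hF.isPoly a b).continuous.continuousOn (s := refCell k)
  have hq := hF.isPoly_jacDet.continuous.continuousOn (s := refCell k)
  have hg := fun a b => (hF.isPoly_piolaGrad hz a b).continuous.continuousOn (s := refCell k)
  have hq0 : ∀ x ∈ refCell k, jacDet F x ^ 3 ≠ 0 := fun x hx =>
    pow_ne_zero 3 (hF.jacDet_ne_zero hh (refCell_subset k hx))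
  have h0 : ∀ a, ContinuousOn (fun x => ((piolaGrad F z a 0 x * jac F 1 1 x -
      piolaGrad F z a 1 x * jac F 1 0 x) / jacDet F x ^ 3) ^ 2) (refCell k) := fun a =>
    (((((hg a 0).mul (hJ 1 1)).sub ((hg a 1).mul (hJ 1 0))).div (hq.pow 3) hq0).pow 2)
  have h1 : ∀ a, ContinuousOn (fun x => ((piolaGrad F z a 1 x * jac F 0 0 x -
      piolaGrad F z a 0 x * jac F 0 1 x) / jacDet F x ^ 3) ^ 2) (refCell k) := fun a =>
    (((((hg a 1).mul (hJ 0 0)).sub ((hg a 0).mul (hJ 0 1))).div (hq.pow 3) hq0).pow 2)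
  have hc := hq.abs.mul (((h0 0).add (h1 0)).add ((h0 1).add (h1 1)))
  refine ((hc.integrableOn_compact (isCompact_refCell k)).mono_set interior_subset).congr_fun
    (fun x hx => ?_) isOpen_interior.measurableSet
  simp only [gradSq_eq, (hF.jac_comp_eq hz hh hv hx _).1, (hF.jac_comp_eq hz hh hv hx _).2]
  rfl

theorem integrableOn_gradSq_cell (hF : IsQuadChart K h F) (hz : ∀ a, IsPolyFun 2 (z a))
    (hh : 0 < h) (hv : ∀ x ∈ refCell k, ∀ a, v (F x) a = piola F z a x) :
    IntegrableOn (gradSq v) (F '' interior (refCell k)) := by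
  rw [integrableOn_image_iff_integrableOn_abs_det_fderiv_smul volume
    isOpen_interior.measurableSet (hF.hasFDerivWithinAt _) (hF.injOn_interior k)]
  simpa only [det_fderiv_eq, smul_eq_mul] using hF.integrableOn_jacDet_mul_gradSq hz hh hv

/-- The open cells leave out only their boundaries, which are null sets because the cells are
convex, and a differentiable map sends null sets to null sets. The values of `fderiv` on the
skeleton of the split thus play no role. -/
theorem integrableOn_gradSq_image (hF : IsQuadChart K h F)
    (hint : ∀ k, IntegrableOn (gradSq v) (F '' interior (refCell k))) :
    IntegrableOn (gradSq v) (F '' refTriangle) := by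
  have hsub : F '' refTriangle ⊆ ⋃ k, F '' interior (refCell k) ∪ F '' frontier (refCell k) := by
    rintro _ ⟨x, hx, rfl⟩
    obtain ⟨k, hk⟩ := mem_iUnion.1 (refTriangle_subset hx)
    refine mem_iUnion.2 ⟨k, ?_⟩
    rw [← image_union, ← closure_eq_interior_union_frontier]
    exact mem_image_of_mem F (subset_closure hk)
  refine IntegrableOn.mono_set ?_ hsub
  rw [integrableOn_finite_iUnion]
  intro k
  refine (hint k).union (IntegrableOn.of_measure_zero ?_)
  refine addHaar_image_eq_zero_of_differentiableOn_of_addHaar_eq_zero volume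
    (hF.contDiff.differentiable (by norm_num)).differentiableOn ?_
  exact (convex_convexHull ℝ _).addHaar_frontier volume

theorem setIntegral_piolaGrad_sq_le (hF : IsQuadChart K h F) (hz : ∀ a, IsPolyFun 2 (z a))
    (hh : 0 < h) (hK : 0 < K) (hv : ∀ x ∈ refCell k, ∀ a, v (F x) a = piola F z a x)
    (hint : IntegrableOn (gradSq v) (F '' refTriangle)) (a b : Fin 2) :
    ∫ x in interior (refCell k), piolaGrad F z a b x ^ 2 ≤
      (32 * K ^ 11 * h ^ 8) * gradNorm (F '' refTriangle) v ^ 2 := by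
  have hg := (hF.isPoly_piolaGrad hz a b).continuous
  have hi1 : IntegrableOn (fun x => piolaGrad F z a b x ^ 2) (interior (refCell k)) :=
    ((hg.pow 2).continuousOn.integrableOn_compact (isCompact_refCell k)).mono_set interior_subset
  have hi2 := (hF.integrableOn_jacDet_mul_gradSq hz hh hv).const_mul (32 * K ^ 11 * h ^ 8)
  have hnn : 0 ≤ ∫ x in F '' refTriangle, gradSq v x := integral_nonneg fun x => gradSq_nonneg v x
  have hcov := integral_image_eq_integral_abs_det_fderiv_smul volume
    isOpen_interior.measurableSet (hF.hasFDerivWithinAt _) (hF.injOn_interior k) (gradSq v)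
  simp only [det_fderiv_eq, smul_eq_mul] at hcov
  calc ∫ x in interior (refCell k), piolaGrad F z a b x ^ 2
      ≤ ∫ x in interior (refCell k), (32 * K ^ 11 * h ^ 8) * (|jacDet F x| * gradSq v (F x)) :=
        setIntegral_mono_on hi1 hi2 isOpen_interior.measurableSet
          fun x hx => hF.piolaGrad_sq_le hz hh hv hx a b
    _ = (32 * K ^ 11 * h ^ 8) * ∫ x in F '' interior (refCell k), gradSq v x := by
        rw [integral_const_mul, hcov]
    _ ≤ (32 * K ^ 11 * h ^ 8) * ∫ x in F '' refTriangle, gradSq v x := by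
        refine mul_le_mul_of_nonneg_left (setIntegral_mono_set hint
          (Filter.Eventually.of_forall fun x => gradSq_nonneg v x) ?_) (by positivity)
        exact (image_mono (interior_subset.trans (refCell_subset k))).eventuallyLE
    _ = _ := by rw [gradNorm, Real.sq_sqrt hnn]

/-- The inverse estimate turns the `L²`-bound of order `h ^ 4` for `piolaGrad` into a pointwise one,
and division by `(det DF)²`, which is at least of order `h ^ 4`, cancels the powers of `h`. The
estimate passes from one cell to the whole triangle, since `z` consists of polynomials. -/
theorem exists_abs_partialDeriv_piola_le (hK : 0 < K) (k : Fin 3) :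
    ∃ C : ℝ, 0 ≤ C ∧ ∀ {h : ℝ} {F v : Plane → Plane} {z : Fin 2 → Plane → ℝ},
      IsQuadChart K h F → (∀ a, IsPolyFun 2 (z a)) → 0 < h →
      (∀ x ∈ refCell k, ∀ a, v (F x) a = piola F z a x) →
      IntegrableOn (gradSq v) (F '' refTriangle) → ∀ x ∈ refTriangle, ∀ a b : Fin 2,
        |partialDeriv b (piola F z a) x| ≤ C * gradNorm (F '' refTriangle) v := by
  obtain ⟨C, hC, hinv⟩ := exists_inverse_estimate 5 isOpen_interior (nonempty_interior_refCell k)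
    ((isCompact_refCell k).isBounded.subset interior_subset) isCompact_refTriangle
  refine ⟨C * Real.sqrt (32 * K ^ 11) * K ^ 2, by positivity, ?_⟩
  intro h F v z hF hz hh hv hint x hx a b
  have hq := hF.jacDet_ne_zero hh hx
  have hG : 0 ≤ gradNorm (F '' refTriangle) v := Real.sqrt_nonneg _
  have h1 := hinv _ (hF.isPoly_piolaGrad hz a b) x hx
  have h2 : Real.sqrt (∫ x in interior (refCell k), piolaGrad F z a b x ^ 2) ≤
      Real.sqrt (32 * K ^ 11) * (h ^ 4 * gradNorm (F '' refTriangle) v) := by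
    calc _ ≤ Real.sqrt ((32 * K ^ 11) * (h ^ 4 * gradNorm (F '' refTriangle) v) ^ 2) :=
          Real.sqrt_le_sqrt ((hF.setIntegral_piolaGrad_sq_le hz hh hK hv hint a b).trans_eq
            (by ring))
      _ = _ := by rw [Real.sqrt_mul (by positivity), Real.sqrt_sq (by positivity)]
  have h3 : h ^ 4 ≤ K ^ 2 * jacDet F x ^ 2 := by
    calc h ^ 4 = (h ^ 2) ^ 2 := by ring
      _ ≤ (K * |jacDet F x|) ^ 2 := by
        gcongr
        exact hF.det_bound x hx
      _ = _ := by rw [mul_pow, sq_abs]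
  rw [hF.partialDeriv_piola hz hh hx, abs_div, abs_of_nonneg (sq_nonneg (jacDet F x)),
    div_le_iff₀ (by positivity)]
  calc _ ≤ C * (Real.sqrt (32 * K ^ 11) * (h ^ 4 * gradNorm (F '' refTriangle) v)) :=
        h1.trans (by gcongr)
    _ ≤ C * (Real.sqrt (32 * K ^ 11) *
        ((K ^ 2 * jacDet F x ^ 2) * gradNorm (F '' refTriangle) v)) := by gcongr
    _ = _ := by ring

end IsQuadChart

/-! ### Simpson's rule for the Piola transform along an edge -/

theorem hasDerivAt_comp_refEdge {f : Plane → ℝ} {k : Fin 3} {t : ℝ}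
    (hf : DifferentiableAt ℝ f (refEdge k t)) :
    HasDerivAt (fun t => f (refEdge k t))
      (partialDeriv 0 f (refEdge k t) * (refVertex (k + 2) - refVertex (k + 1)) 0 +
        partialDeriv 1 f (refEdge k t) * (refVertex (k + 2) - refVertex (k + 1)) 1) t := by
  have h := hf.hasFDerivAt.comp_hasDerivAt t
    (AffineMap.hasDerivAt_lineMap (a := refVertex (k + 1)) (b := refVertex (k + 2)))
  refine h.congr_deriv ?_
  conv_lhs => rw [eq_sum_single (refVertex (k + 2) - refVertex (k + 1))]
  rw [Fin.sum_univ_two, map_add, map_smul, map_smul, partialDeriv, partialDeriv, smul_eq_mul,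
    smul_eq_mul]
  ring

theorem abs_refVertex_sub_le (k : Fin 3) (b : Fin 2) :
    |(refVertex (k + 2) - refVertex (k + 1)) b| ≤ 1 := by
  fin_cases k <;> fin_cases b <;> simp [refVertex]

theorem IsPolyFun.comp_refEdge {f : Plane → ℝ} (hf : IsPolyFun 1 f) (k : Fin 3) (t : ℝ) :
    f (refEdge k t) = f (refVertex (k + 1)) + t * (f (refVertex (k + 2)) - f (refVertex (k + 1))) := by
  obtain ⟨P, hP, hfP⟩ := hf.comp_lineMap (refVertex (k + 1)) (refVertex (k + 2))
  have h : ∀ t : ℝ, f (refEdge k t) = P.coeff 0 + P.coeff 1 * t := by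
    intro t
    rw [refEdge, hfP, Polynomial.eval_eq_sum_range' (Nat.lt_succ_of_le hP)]
    simp [Finset.sum_range_succ]
  have h0 := h 0
  have h1 := h 1
  rw [refEdge_zero] at h0
  rw [refEdge_one] at h1
  rw [h, h0, h1]
  ring


theorem IsQuadChart.continuousOn_piola_refEdge {K h : ℝ} {F : Plane → Plane}
    {z : Fin 2 → Plane → ℝ} (hF : IsQuadChart K h F) (hz : ∀ a, IsPolyFun 2 (z a)) (hh : 0 < h)
    (k : Fin 3) (a : Fin 2) :
    ContinuousOn (fun t => piola F z a (refEdge k t)) (Icc 0 1) := fun _ ht =>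
  (hasDerivAt_comp_refEdge
    (hF.differentiableAt_piola hz hh (refEdge_mem k ht) a)).continuousAt.continuousWithinAt

theorem IsQuadChart.abs_piola_sub_le {K h B : ℝ} {F : Plane → Plane}
    {z : Fin 2 → Plane → ℝ} (hF : IsQuadChart K h F) (hz : ∀ a, IsPolyFun 2 (z a)) (hh : 0 < h)
    (hB : ∀ x ∈ refTriangle, ∀ a b : Fin 2, |partialDeriv b (piola F z a) x| ≤ B)
    (k : Fin 3) (a : Fin 2) {t : ℝ} (ht : t ∈ Icc (0 : ℝ) 1) :
    |piola F z a (refEdge k t) - piola F z a (refEdge k 0)| ≤ 2 * B := by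
  have hB0 : 0 ≤ B := (abs_nonneg _).trans (hB _ (refEdge_mem k ht) 0 0)
  have hd : ∀ s ∈ Icc (0 : ℝ) 1, HasDerivWithinAt (fun t => piola F z a (refEdge k t)) _
      (Icc 0 1) s := fun s hs => (hasDerivAt_comp_refEdge
    (hF.differentiableAt_piola hz hh (refEdge_mem k hs) a)).hasDerivWithinAt
  have := (convex_Icc (0 : ℝ) 1).norm_image_sub_le_of_norm_hasDerivWithin_le (C := 2 * B) hd
    (fun s hs => ?_) (left_mem_Icc.2 zero_le_one) ht
  · refine this.trans ?_
    rw [sub_zero, Real.norm_of_nonneg ht.1]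
    exact mul_le_of_le_one_right (by positivity) ht.2
  · have hm := refEdge_mem k hs
    calc _ ≤ _ + _ := norm_add_le _ _
      _ ≤ B * 1 + B * 1 := by
        rw [norm_mul, norm_mul]
        gcongr
        exacts [hB _ hm _ _, abs_refVertex_sub_le k _, hB _ hm _ _, abs_refVertex_sub_le k _]
      _ = _ := by ring

/-- Estimate for the error of Simpson's rule on an edge for the Piola transform of a quadratic
field. -/
theorem IsQuadChart.abs_simpsonError_piola_le {K h B : ℝ} {F : Plane → Plane}
    {z : Fin 2 → Plane → ℝ} (hF : IsQuadChart K h F) (hz : ∀ a, IsPolyFun 2 (z a)) (hh : 0 < h)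
    (hK : 0 < K) (hB : ∀ x ∈ refTriangle, ∀ a b : Fin 2, |partialDeriv b (piola F z a) x| ≤ B)
    (k : Fin 3) (a : Fin 2) :
    |simpsonError (fun t => piola F z a (refEdge k t))| ≤
      (16 * K * (4 * K ^ 5 + 36 * K ^ 8)) * h ^ 2 * B := by
  set p := refVertex (k + 1)
  set r := refVertex (k + 2)
  have hp : p ∈ refTriangle := refVertex_mem _
  have hr : r ∈ refTriangle := refVertex_mem _
  -- values at the first end point
  set c : Fin 2 → ℝ := fun a => piola F z a (refEdge k 0)
  have hsub : ∀ a, ∀ t ∈ Icc (0 : ℝ) 1, |piola F z a (refEdge k t) - c a| ≤ 2 * B :=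
    fun a t ht => hF.abs_piola_sub_le hz hh hB k a ht
  have hB0 : 0 ≤ B := (abs_nonneg _).trans (hB p hp 0 0)
  -- the field `z` minus the field with constant Piola transform `c`
  let ζ : Fin 2 → Plane → ℝ := ![fun x => z 0 x - (c 0 * jac F 1 1 x - c 1 * jac F 0 1 x),
    fun x => z 1 x - (c 1 * jac F 0 0 x - c 0 * jac F 1 0 x)]
  -- The subtracted field is the adjugate of `DF` applied to `c`, whose entries are those of `DF` up
  -- to sign and order, hence affine.
  have hζ : ∀ b, IsPolyFun 2 (ζ b) := by
    intro b
    fin_cases b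
    · exact (hz 0).sub ((((hF.isPoly 1 1).const_mul _).sub
        ((hF.isPoly 0 1).const_mul _)).mono one_le_two)
    · exact (hz 1).sub ((((hF.isPoly 0 0).const_mul _).sub
        ((hF.isPoly 1 0).const_mul _)).mono one_le_two)
  choose P hP hPζ using fun b => (hζ b).comp_lineMap p r
  -- Here `ζ` is the adjugate of `DF` applied to the Piola transform minus `c`: the first factor has
  -- entries of size `K h`, the second of size `2 B`.
  have hζle : ∀ b, ∀ t ∈ Icc (0 : ℝ) 1, |ζ b (refEdge k t)| ≤ 4 * K * h * B := by
    intro b t ht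
    have hm := refEdge_mem k ht
    have hq := hF.jacDet_ne_zero hh hm
    have hJ := hF.bound _ hm
    have key : ∀ e f : ℝ, |e| ≤ K * h → |f| ≤ K * h → ∀ a a' : Fin 2,
        |e * (piola F z a (refEdge k t) - c a) - f * (piola F z a' (refEdge k t) - c a')| ≤
          4 * K * h * B := by
      intro e f he hf a a'
      calc _ ≤ |e * (piola F z a (refEdge k t) - c a)| +
            |f * (piola F z a' (refEdge k t) - c a')| := abs_sub _ _
        _ ≤ (K * h) * (2 * B) + (K * h) * (2 * B) := by
          rw [abs_mul, abs_mul]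
          gcongr
          exacts [hsub a t ht, hsub a' t ht]
        _ = _ := by ring
    fin_cases b
    · convert key _ _ (hJ 1 1) (hJ 0 1) 0 1 using 2
      change z 0 _ - (c 0 * jac F 1 1 _ - c 1 * jac F 0 1 _) = _
      simp only [piola, piolaNum]
      field_simp
      simp only [jacDet]
      ring
    · convert key _ _ (hJ 0 0) (hJ 1 0) 1 0 using 2
      change z 1 _ - (c 1 * jac F 0 0 _ - c 0 * jac F 1 0 _) = _
      simp only [piola, piolaNum]
      field_simp
      simp only [jacDet]
      ring
  -- the determinant along the edge
  set s : Fin 2 → Fin 2 → ℝ := fun a b => jac F a b r - jac F a b p with hs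
  have hline : ∀ a b t, jac F a b (refEdge k t) = jac F a b p + t * s a b := fun a b t =>
    (hF.isPoly a b).comp_refEdge k t
  set d₀ := jacDet F p with hd0
  set d₁ := jac F 0 0 p * s 1 1 + s 0 0 * jac F 1 1 p - (jac F 0 1 p * s 1 0 + s 0 1 * jac F 1 0 p)
    with hd1
  set d₂ := s 0 0 * s 1 1 - s 0 1 * s 1 0 with hd2
  have hdet : ∀ t, jacDet F (refEdge k t) = d₀ + d₁ * t + d₂ * t ^ 2 := by
    intro t
    simp only [jacDet, hline, hd0, hd1, hd2]
    ring
  have hd0ne : d₀ ≠ 0 := hF.jacDet_ne_zero hh hp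
  have hJp := hF.bound p hp
  have hs1 : ∀ a b, |s a b| ≤ K * h ^ 2 := hF.osc p hp r hr
  -- This bound has one power of `h` less than `hs1`; it yields the second of the two bounds for
  -- `d₁` that the remainder estimate requires.
  have hs2 : ∀ a b, |s a b| ≤ 2 * (K * h) := fun a b =>
    (abs_sub _ _).trans (by linarith [hF.bound p hp a b, hF.bound r hr a b])
  have hd1le : ∀ S : ℝ, 0 ≤ S → (∀ a b, |s a b| ≤ S) → |d₁| ≤ 4 * (K * h * S) := by
    intro S hS hsS
    calc |d₁| ≤ |jac F 0 0 p * s 1 1 + s 0 0 * jac F 1 1 p| +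
          |jac F 0 1 p * s 1 0 + s 0 1 * jac F 1 0 p| := abs_sub _ _
      _ ≤ (|jac F 0 0 p * s 1 1| + |s 0 0 * jac F 1 1 p|) +
          (|jac F 0 1 p * s 1 0| + |s 0 1 * jac F 1 0 p|) := by
        gcongr <;> exact abs_add_le _ _
      _ ≤ ((K * h) * S + S * (K * h)) + ((K * h) * S + S * (K * h)) := by
        simp only [abs_mul]
        gcongr
        exacts [hJp 0 0, hsS 1 1, hsS 0 0, hJp 1 1, hJp 0 1, hsS 1 0, hsS 0 1, hJp 1 0]
      _ = _ := by ring
  have hd2le : |d₂| ≤ 2 * K ^ 2 * h ^ 4 := by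
    calc |d₂| ≤ |s 0 0 * s 1 1| + |s 0 1 * s 1 0| := abs_sub _ _
      _ ≤ (K * h ^ 2) * (K * h ^ 2) + (K * h ^ 2) * (K * h ^ 2) := by
        simp only [abs_mul]
        gcongr <;> exact hs1 _ _
      _ = _ := by ring
  -- the polynomial part
  set Q : Polynomial ℝ := Polynomial.C (c a) + ∑ b, (Polynomial.C (jac F a b p / d₀) +
    Polynomial.C (s a b / d₀ - jac F a b p * d₁ / d₀ ^ 2) * Polynomial.X) * P b with hQ
  -- Affine times quadratic: three is the highest degree for which Simpson's rule is exact.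
  have hQdeg : Q.natDegree ≤ 3 := by
    refine (Polynomial.natDegree_add_le _ _).trans (max_le (by simp) ?_)
    refine Polynomial.natDegree_sum_le_of_forall_le _ _ fun b _ => ?_
    refine Polynomial.natDegree_mul_le.trans (add_le_add (b := 1) (d := 2) ?_ (hP b))
    compute_degree
  -- The remainder of `DF / det DF` is of order `h` and `ζ` of order `h B`; this product is where `h
  -- ^ 2` comes from.
  have hrem : ∀ t ∈ Icc (0 : ℝ) 1, |piola F z a (refEdge k t) - Q.eval t| ≤
      (8 * K * (4 * K ^ 5 + 36 * K ^ 8)) * h ^ 2 * B := by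
    intro t ht
    have hm := refEdge_mem k ht
    have hq := hF.jacDet_ne_zero hh hm
    have hPt : ∀ b, (P b).eval t = ζ b (refEdge k t) := fun b => (hPζ b t).symm
    -- The Piola transform of the adjugate field is the constant `c`, so only `ζ` is left to
    -- transform.
    have hexp : piola F z a (refEdge k t) = c a + ∑ b, (jac F a b p + t * s a b) /
        (d₀ + d₁ * t + d₂ * t ^ 2) * ζ b (refEdge k t) := by
      simp only [← hline, ← hdet, Fin.sum_univ_two]
      simp only [ζ, Matrix.cons_val_zero, Matrix.cons_val_one, piola, piolaNum]
      field_simp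
      fin_cases a
      · simp only [jacDet, Fin.zero_eta]
        ring
      · simp only [jacDet, Fin.mk_one]
        ring
    rw [hdet] at hq
    have hRle : ∀ b, _ := fun b => abs_affine_div_quadratic_remainder_le
      (d₀ := d₀) (d₁ := d₁) (d₂ := d₂) (a := jac F a b p) (s := s a b) hh hK ht
      (hF.det_bound p hp) (hF.abs_jacDet_le hp) (hdet t ▸ hF.det_bound _ hm)
      ((hd1le _ (by positivity) hs1).trans_eq (by ring))
      ((hd1le _ (by positivity) hs2).trans_eq (by ring)) hd2le
      (hline a b t ▸ hF.bound _ hm a b) (hs1 a b)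
    simp only [affine_div_quadratic hd0ne hq] at hexp
    set R : Fin 2 → ℝ := fun b => -(s a b * d₁ / d₀ ^ 2) * t ^ 2 + (jac F a b p + t * s a b) *
      (t ^ 2 * (-d₂ * d₀ + d₁ ^ 2 + d₁ * d₂ * t) / (d₀ ^ 2 * (d₀ + d₁ * t + d₂ * t ^ 2))) with hR
    have hdiff : piola F z a (refEdge k t) - Q.eval t =
        R 0 * ζ 0 (refEdge k t) + R 1 * ζ 1 (refEdge k t) := by
      rw [hexp, hQ]
      simp only [Fin.sum_univ_two, Polynomial.eval_add, Polynomial.eval_mul, Polynomial.eval_C,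
        Polynomial.eval_X, hPt, hR]
      ring
    rw [hdiff]
    calc _ ≤ |R 0 * ζ 0 (refEdge k t)| + |R 1 * ζ 1 (refEdge k t)| := abs_add_le _ _
      _ ≤ ((4 * K ^ 5 + 36 * K ^ 8) * h) * (4 * K * h * B) +
          ((4 * K ^ 5 + 36 * K ^ 8) * h) * (4 * K * h * B) := by
        rw [abs_mul, abs_mul]
        gcongr
        exacts [hRle 0, hζle 0 t ht, hRle 1, hζle 1 t ht]
      _ = _ := by ring
  have hcont := hF.continuousOn_piola_refEdge hz hh k a
  have hadd := simpsonError_add (f := fun t => Q.eval t)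
    (g := fun t => piola F z a (refEdge k t) - Q.eval t)
    Q.continuous.continuousOn (hcont.sub Q.continuous.continuousOn)
  simp only [add_sub_cancel] at hadd
  rw [hadd, simpsonError_polynomial hQdeg, zero_add]
  exact (abs_simpsonError_le hrem).trans_eq (by ring)

/-- The estimate on a single curved triangle. -/
theorem exists_abs_simpsonError_le {K : ℝ} (hK : 0 < K) :
    ∃ C : ℝ, 0 ≤ C ∧ ∀ {h : ℝ} {F v w : Plane → Plane}, IsQuadChart K h F → 0 < h →
      w ∈ refVelocity →
      (∀ x ∈ refTriangle, v (F x) = ((fderiv ℝ F x).det⁻¹ • fderiv ℝ F x) (w x)) →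
      IntegrableOn (gradSq v) (F '' refTriangle) ∧ ∀ (k : Fin 3) (a : Fin 2),
        ContinuousOn (fun t => v (F (refEdge k t)) a) (Icc 0 1) ∧
        |simpsonError (fun t => v (F (refEdge k t)) a)| ≤
          C * h ^ 2 * gradNorm (F '' refTriangle) v := by
  choose C hC hgrad using IsQuadChart.exists_abs_partialDeriv_piola_le hK
  refine ⟨(16 * K * (4 * K ^ 5 + 36 * K ^ 8)) * ∑ k, C k,
    mul_nonneg (by positivity) (Finset.sum_nonneg fun k _ => hC k), ?_⟩
  intro h F v w hF hh hw hvw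
  choose p hp hwp using hw.2.2
  let z : Fin 3 → Fin 2 → Plane → ℝ := fun k a x => MvPolynomial.eval (fun b => x b) (p k a)
  have hz : ∀ k a, IsPolyFun 2 (z k a) := fun k a => ⟨p k a, hp k a, fun _ => rfl⟩
  have hv : ∀ k, ∀ x ∈ refCell k, ∀ a, v (F x) a = piola F (z k) a x := by
    intro k x hx a
    rw [hvw x (refCell_subset k hx), _root_.smul_apply, PiLp.smul_apply,
      fderiv_apply_eq_sum, det_fderiv_eq, piola, piolaNum, Fin.sum_univ_two, hwp k 0 x hx,
      hwp k 1 x hx, smul_eq_mul]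
    ring
  have hint := hF.integrableOn_gradSq_image (v := v) fun k =>
    hF.integrableOn_gradSq_cell (hz k) hh (hv k)
  refine ⟨hint, fun k a => ?_⟩
  -- Edge `k` lies in cell `k`, so a single polynomial piece describes the whole trace.
  have heq : EqOn (fun t => v (F (refEdge k t)) a) (fun t => piola F (z k) a (refEdge k t))
    (Icc 0 1) := fun t ht => hv k _ (refEdge_mem_refCell k ht) a
  refine ⟨(hF.continuousOn_piola_refEdge (hz k) hh k a).congr heq, ?_⟩
  rw [simpsonError_congr heq]
  refine (hF.abs_simpsonError_piola_le (hz k) hh hK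
    (hgrad k hF (hz k) hh (hv k) hint) k a).trans ?_
  have hCk : C k ≤ ∑ k, C k := Finset.single_le_sum (fun k _ => hC k) (Finset.mem_univ k)
  have hG : 0 ≤ gradNorm (F '' refTriangle) v := Real.sqrt_nonneg _
  calc _ ≤ (16 * K * (4 * K ^ 5 + 36 * K ^ 8)) * h ^ 2 *
        ((∑ k, C k) * gradNorm (F '' refTriangle) v) := by gcongr
    _ = _ := by ring


/-! ### Affine charts -/

/-- The linear parts of the barycentric coordinates of the reference triangle. -/
def refBaryLin (k : Fin 3) : Plane →L[ℝ] ℝ :=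
  ![-(EuclideanSpace.proj 0 + EuclideanSpace.proj 1), EuclideanSpace.proj 0,
    EuclideanSpace.proj 1] k

theorem hasFDerivAt_refBary (k : Fin 3) (x : Plane) :
    HasFDerivAt (refBary k) (refBaryLin k) x := by
  have h0 := (EuclideanSpace.proj 0 : Plane →L[ℝ] ℝ).hasFDerivAt (x := x)
  have h1 := (EuclideanSpace.proj 1 : Plane →L[ℝ] ℝ).hasFDerivAt (x := x)
  fin_cases k
  · refine ((h0.add h1).const_sub 1).congr_of_eventuallyEq (Filter.Eventually.of_forall fun y => ?_)
    simp [refBary]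
    ring
  · exact h0
  · exact h1

theorem refBaryLin_sub (k : Fin 3) (x y : Plane) :
    refBaryLin k (y - x) = refBary k y - refBary k x := by
  fin_cases k <;> simp [refBary, refBaryLin]
  ring

theorem isPoly_refBary (k : Fin 3) : IsPolyFun 1 (refBary k) := by
  have h0 := IsPolyFun.coord 0
  have h1 := IsPolyFun.coord 1
  fin_cases k
  · exact ((IsPolyFun.const 1 1).sub h0).sub h1
  · exact h0
  · exact h1

theorem sum_refBary (x : Plane) : ∑ k, refBary k x = 1 := by
  simp [Fin.sum_univ_three, refBary]
  ring

theorem refBary_refVertex (k j : Fin 3) : refBary k (refVertex j) = if k = j then 1 else 0 := by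
  fin_cases k <;> fin_cases j <;> simp [refBary, refVertex]

theorem refBary_refEdge (k j : Fin 3) (t : ℝ) :
    refBary j (refEdge k t) = (1 - t) * (if j = k + 1 then 1 else 0) +
      t * (if j = k + 2 then 1 else 0) := by
  have h := (isPoly_refBary j).comp_refEdge k t
  rw [h, refBary_refVertex, refBary_refVertex]
  ring

/-- The linear part of the affine map of the reference triangle onto the triangle `p`. -/
def affineLin (p : AffineBasis (Fin 3) ℝ Plane) : Plane →L[ℝ] Plane :=
  (EuclideanSpace.proj 0 : Plane →L[ℝ] ℝ).smulRight (p 1 - p 0) +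
    (EuclideanSpace.proj 1 : Plane →L[ℝ] ℝ).smulRight (p 2 - p 0)

variable (p : AffineBasis (Fin 3) ℝ Plane)

theorem affineMap_eq (x : Plane) : affineMap p x = p 0 + affineLin p x := by
  simp only [affineMap, affineLin, Fin.sum_univ_three, refBary, Matrix.cons_val_zero,
    Matrix.cons_val_one, Matrix.cons_val, _root_.add_apply,
    ContinuousLinearMap.smulRight_apply, PiLp.proj_apply]
  module

theorem affineLin_sub (x y : Plane) : affineLin p (y - x) = affineMap p y - affineMap p x := by
  rw [affineMap_eq, affineMap_eq, map_sub]
  abel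

theorem affineLin_single (b : Fin 2) :
    affineLin p (EuclideanSpace.single b 1) = p b.succ - p 0 := by
  fin_cases b <;> simp [affineLin]

theorem hasFDerivAt_affineMap (x : Plane) : HasFDerivAt (affineMap p) (affineLin p) x := by
  rw [funext (affineMap_eq p)]
  exact (affineLin p).hasFDerivAt.const_add _

theorem contDiff_affineMap {n : WithTop ℕ∞} : ContDiff ℝ n (affineMap p) := by
  rw [funext (affineMap_eq p)]
  exact contDiff_const.add (affineLin p).contDiff

theorem coord_affineMap (k : Fin 3) (x : Plane) : p.coord k (affineMap p x) = refBary k x := by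
  rw [affineMap, ← Finset.univ.affineCombination_eq_linear_combination p (fun k => refBary k x)
    (sum_refBary x), p.coord_apply_combination_of_mem (Finset.mem_univ k) (sum_refBary x)]

theorem affineMap_refVertex (k : Fin 3) : affineMap p (refVertex k) = p k := by
  simp [affineMap, refBary_refVertex]

/-- The point of the reference plane with the barycentric coordinates of `X`. -/
theorem exists_affineMap_eq (X : Plane) : ∃ x, affineMap p x = X ∧
    ∀ k, refBary k x = p.coord k X := by
  have hs := p.sum_coord_apply_eq_one X
  rw [Fin.sum_univ_three] at hs
  have hb : ∀ k, refBary k (!₂[p.coord 1 X, p.coord 2 X] : Plane) = p.coord k X := by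
    intro k
    fin_cases k <;> simp [refBary]
    linarith
  refine ⟨!₂[p.coord 1 X, p.coord 2 X], ?_, hb⟩
  simp only [affineMap, hb]
  exact p.linear_combination_coord_eq_self X

theorem mem_convexHull_iff {X : Plane} : X ∈ convexHull ℝ (range p) ↔ ∀ k, 0 ≤ p.coord k X := by
  rw [p.convexHull_eq_nonneg_coord]
  rfl

theorem affineMap_mem {x : Plane} (hx : x ∈ refTriangle) :
    affineMap p x ∈ convexHull ℝ (range p) :=
  (mem_convexHull_iff p).2 fun k => by
    rw [coord_affineMap]
    exact refBary_nonneg hx k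

theorem image_affineMap_refTriangle : affineMap p '' refTriangle = convexHull ℝ (range p) := by
  refine Subset.antisymm (image_subset_iff.2 fun x hx => affineMap_mem p hx) fun X hX => ?_
  obtain ⟨x, hx, hb⟩ := exists_affineMap_eq p X
  exact ⟨x, mem_refTriangle fun k => by rw [hb]; exact (mem_convexHull_iff p).1 hX k, hx⟩

theorem affineMap_refEdge (k : Fin 3) (t : ℝ) :
    affineMap p (refEdge k t) = AffineMap.lineMap (p (k + 1)) (p (k + 2)) t := by
  rw [← affineMap_refVertex p (k + 1), ← affineMap_refVertex p (k + 2), affineMap_eq, affineMap_eq,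
    affineMap_eq, refEdge]
  simp only [AffineMap.lineMap_apply_module, map_add, map_smul]
  module

/-- The barycentric coordinates along the segment between two points. -/
theorem coord_lineMap (k : Fin 3) (X Y : Plane) (t : ℝ) :
    p.coord k (AffineMap.lineMap X Y t) = (1 - t) * p.coord k X + t * p.coord k Y := by
  rw [AffineMap.apply_lineMap, AffineMap.lineMap_apply_module, smul_eq_mul, smul_eq_mul]

theorem coord_midpoint (k : Fin 3) (X Y : Plane) :
    p.coord k (midpoint ℝ X Y) = (p.coord k X + p.coord k Y) / 2 := by
  rw [midpoint, coord_lineMap]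
  norm_num
  ring

theorem sub_eq_coord_smul (k : Fin 3) (X : Plane) :
    X - p (k + 1) = p.coord k X • (p k - p (k + 1)) +
      p.coord (k + 2) X • (p (k + 2) - p (k + 1)) := by
  have hs := p.sum_coord_apply_eq_one X
  have hX := p.linear_combination_coord_eq_self X
  rw [Fin.sum_univ_three] at hs hX
  have h0 : p.coord 0 X = 1 - p.coord 1 X - p.coord 2 X := by linarith
  conv_lhs => rw [← hX]
  fin_cases k <;> simp only [Fin.zero_eta, Fin.mk_one, Fin.reduceFinMk, Fin.reduceAdd, zero_add, h0] <;> module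

/-- If the triangle `p` contains a ball of radius `r`, the gradients of the barycentric
coordinates are at most `1 / (2 r)`. -/
theorem abs_coord_linear_le {c : Plane} {r : ℝ} (hr : 0 < r)
    (hball : Metric.closedBall c r ⊆ convexHull ℝ (range p)) (k : Fin 3) {e : Plane}
    (he : ‖e‖ = 1) : 2 * r * |(p.coord k).linear e| ≤ 1 := by
  have hmem : ∀ X ∈ Metric.closedBall c r, 0 ≤ p.coord k X ∧ p.coord k X ≤ 1 := by
    intro X hX
    have h := (mem_convexHull_iff p).1 (hball hX)
    refine ⟨h k, ?_⟩
    rw [← p.sum_coord_apply_eq_one X]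
    exact Finset.single_le_sum (fun k _ => h k) (Finset.mem_univ k)
  have hball' : ∀ s : ℝ, |s| ≤ r → s • e + c ∈ Metric.closedBall c r := by
    intro s hs
    rw [Metric.mem_closedBall, dist_add_self_left, norm_smul, he, mul_one]
    exact hs
  have hval : ∀ s : ℝ, p.coord k (s • e + c) = s * (p.coord k).linear e + p.coord k c := by
    intro s
    rw [← vadd_eq_add, AffineMap.map_vadd, map_smul, smul_eq_mul, vadd_eq_add]
  -- Along a diameter of the disc in direction `e`, of length `2 r`, the coordinate stays between
  -- `0` and `1`.
  have h1 := hmem _ (hball' r (abs_of_pos hr).le)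
  have h2 := hmem _ (hball' (-r) (by rw [abs_neg, abs_of_pos hr]))
  rw [hval] at h1 h2
  rw [← abs_of_pos (show 0 < 2 * r by positivity), ← abs_mul, abs_le]
  constructor <;> linarith [h1.1, h1.2, h2.1, h2.2]

/-- For `k = 1, 2` this says that the gradients of the barycentric coordinates are the rows of the
inverse of `affineLin p`. -/
theorem coord_linear_affineLin (k : Fin 3) (b : Fin 2) :
    ∑ c, (p.coord k).linear (EuclideanSpace.single c 1) *
      affineLin p (EuclideanSpace.single b 1) c = (if k = b.succ then 1 else 0) -
        (if k = 0 then 1 else 0) := by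
  have h1 : (p.coord k).linear (affineLin p (EuclideanSpace.single b 1)) =
      (if k = b.succ then 1 else 0) - (if k = 0 then 1 else 0) := by
    rw [affineLin_single, ← vsub_eq_sub, AffineMap.linearMap_vsub, p.coord_apply, p.coord_apply,
      vsub_eq_sub]
  rw [← h1]
  conv_rhs => rw [eq_sum_single (affineLin p (EuclideanSpace.single b 1))]
  simp only [Fin.sum_univ_two, map_add, map_smul, smul_eq_mul]
  ring

/-- The inverse matrix has entries of modulus at most `1 / (2 r)`, so its determinant is at most `1
/ r ^ 2` in modulus; the determinant itself is then at least `r ^ 2`. -/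
theorem sq_le_abs_det_affineLin {c : Plane} {r σ h : ℝ} (hr : 0 < r)
    (hball : Metric.closedBall c r ⊆ convexHull ℝ (range p)) (hh : 0 < h) (hσ : h ≤ σ * r) :
    h ^ 2 ≤ σ ^ 2 * |(affineLin p).det| := by
  set L := fun (k : Fin 3) (b : Fin 2) => (p.coord k).linear (EuclideanSpace.single b 1) with hL
  have hle : ∀ k b, r * |L k b| ≤ 1 / 2 := fun k b => by
    linarith [abs_coord_linear_le p hr hball k (e := EuclideanSpace.single b 1) (by simp)]
  have e := coord_linear_affineLin p
  have e10 := (e 1 0).trans (show _ = (1 : ℝ) by simp)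
  have e11 := (e 1 1).trans (show _ = (0 : ℝ) by simp)
  have e20 := (e 2 0).trans (show _ = (0 : ℝ) by simp)
  have e21 := (e 2 1).trans (show _ = (1 : ℝ) by simp)
  rw [Fin.sum_univ_two] at e10 e11 e20 e21
  have hdet : (L 1 0 * L 2 1 - L 1 1 * L 2 0) * (affineLin p).det = 1 := by
    rw [clm_det_eq]
    set B := fun b c => affineLin p (EuclideanSpace.single b 1) c
    change L 1 0 * B 0 0 + L 1 1 * B 0 1 = 1 at e10
    change L 1 0 * B 1 0 + L 1 1 * B 1 1 = 0 at e11
    change L 2 0 * B 0 0 + L 2 1 * B 0 1 = 0 at e20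
    change L 2 0 * B 1 0 + L 2 1 * B 1 1 = 1 at e21
    change (L 1 0 * L 2 1 - L 1 1 * L 2 0) * (B 0 0 * B 1 1 - B 1 0 * B 0 1) = 1
    linear_combination (L 2 0 * B 1 0 + L 2 1 * B 1 1) * e10 -
      (L 2 0 * B 0 0 + L 2 1 * B 0 1) * e11 + e21
  have hLd : r ^ 2 * |L 1 0 * L 2 1 - L 1 1 * L 2 0| ≤ 1 := by
    calc _ ≤ r ^ 2 * (|L 1 0 * L 2 1| + |L 1 1 * L 2 0|) := by gcongr; exact abs_sub _ _
      _ = (r * |L 1 0|) * (r * |L 2 1|) + (r * |L 1 1|) * (r * |L 2 0|) := by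
        rw [abs_mul, abs_mul]; ring
      _ ≤ (1 / 2) * (1 / 2) + (1 / 2) * (1 / 2) := by
        gcongr <;> exact hle _ _
      _ ≤ 1 := by norm_num
  have hdet' : |L 1 0 * L 2 1 - L 1 1 * L 2 0| * |(affineLin p).det| = 1 := by
    rw [← abs_mul, hdet, abs_one]
  have hr2 : r ^ 2 ≤ |(affineLin p).det| := by
    calc r ^ 2 = (r ^ 2 * |L 1 0 * L 2 1 - L 1 1 * L 2 0|) * |(affineLin p).det| := by
          rw [mul_assoc, hdet', mul_one]
      _ ≤ 1 * |(affineLin p).det| := by gcongr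
      _ = _ := one_mul _
  calc h ^ 2 ≤ (σ * r) ^ 2 := by gcongr
    _ = σ ^ 2 * r ^ 2 := by ring
    _ ≤ _ := by gcongr


theorem midpoint_eq_half_smul (X Y : Plane) : midpoint ℝ X Y = (1 / 2 : ℝ) • (X + Y) := by
  rw [midpoint_eq_smul_add, invOf_eq_inv, one_div]

/-- Quadratic interpolation reproduces the identity. As `G` fixes the vertices, only the
displacements of the edge midpoints remain, each carried by its edge bubble. -/
theorem quadInterp_eq (p : AffineBasis (Fin 3) ℝ Plane) {G : Plane → Plane}
    (hG : ∀ k, G (p k) = p k) (X : Plane) :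
    quadInterp p G X = X + ∑ k, (4 * p.coord (k + 1) X * p.coord (k + 2) X) •
      (G (midpoint ℝ (p (k + 1)) (p (k + 2))) - midpoint ℝ (p (k + 1)) (p (k + 2))) := by
  have hs := p.sum_coord_apply_eq_one X
  have hX := p.linear_combination_coord_eq_self X
  rw [Fin.sum_univ_three] at hs hX
  have h0 : p.coord 0 X = 1 - p.coord 1 X - p.coord 2 X := by linarith
  have hX' : X = (1 - p.coord 1 X - p.coord 2 X) • p 0 + p.coord 1 X • p 1 +
    p.coord 2 X • p 2 := by rw [← h0, hX]
  simp only [quadInterp, Fin.sum_univ_three, zero_add, Fin.reduceAdd, hG, h0]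
  generalize p.coord 1 X = b at hX' ⊢
  generalize p.coord 2 X = c at hX' ⊢
  rw [hX']
  simp only [midpoint_eq_half_smul]
  module

end Plane

open Plane

/-! ### Shared edges of a conforming triangulation -/

namespace AffineTriangulation

variable {ι : Type} [Fintype ι] (m : AffineTriangulation ι)

theorem mem_cell_iff {i : ι} {X : Plane} : X ∈ m.cell i ↔ ∀ k, 0 ≤ (m.tri i).coord k X :=
  mem_convexHull_iff _

theorem convex_cell (i : ι) : Convex ℝ (m.cell i) := convex_convexHull ℝ _

theorem isCompact_cell (i : ι) : IsCompact (m.cell i) := (finite_range _).isCompact_convexHull ℝ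

theorem vertex_mem_cell (i : ι) (k : Fin 3) : m.tri i k ∈ m.cell i :=
  subset_convexHull ℝ _ (mem_range_self k)

theorem edge_subset_cell (i : ι) (k : Fin 3) : m.edge i k ⊆ m.cell i :=
  (m.convex_cell i).segment_subset (m.vertex_mem_cell i _) (m.vertex_mem_cell i _)

theorem coord_eq_zero_of_mem_edge {i : ι} {k : Fin 3} {X : Plane} (hX : X ∈ m.edge i k) :
    (m.tri i).coord k X = 0 := by
  rw [edge, segment_eq_image_lineMap] at hX
  obtain ⟨t, -, rfl⟩ := hX
  rw [coord_lineMap, (m.tri i).coord_apply_ne (by fin_cases k <;> decide),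
    (m.tri i).coord_apply_ne (by fin_cases k <;> decide)]
  ring

/-- By conformity a common point lies in the hull of the common vertices; if vertex `k` were not
among them, the coordinate `k` would vanish on that hull. -/
theorem mem_cell_of_coord_ne_zero {i j : ι} {X : Plane} (hi : X ∈ m.cell i) (hj : X ∈ m.cell j)
    {k : Fin 3} (hk : (m.tri i).coord k X ≠ 0) : m.tri i k ∈ range (m.tri j) := by
  by_contra hr
  have hX : X ∈ convexHull ℝ (range (m.tri i) ∩ range (m.tri j)) := by
    rw [← m.conforming]
    exact ⟨hi, hj⟩
  refine hk (convexHull_min (t := {Y | (m.tri i).coord k Y = 0}) ?_ ?_ hX)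
  · rintro _ ⟨⟨l, rfl⟩, hl⟩
    refine (m.tri i).coord_apply_ne ?_
    rintro rfl
    exact hr hl
  · exact (convex_singleton (0 : ℝ)).affine_preimage ((m.tri i).coord k)

theorem interior_cell (i : ι) : interior (m.cell i) = {X | ∀ k, 0 < (m.tri i).coord k X} :=
  (m.tri i).interior_convexHull

theorem vertex_mem_polygon {i : ι} {k : Fin 3} (h : m.tri i k ∉ frontier m.polygon) :
    m.tri i k ∈ m.polygon := by
  have hne : (interior (m.cell i)).Nonempty := ⟨_, (m.tri i).centroid_mem_interior_convexHull⟩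
  have hcl : m.tri i k ∈ closure m.polygon := by
    have h1 := subset_closure (m.vertex_mem_cell i k)
    rw [← (m.convex_cell i).closure_interior_eq_closure_of_nonempty_interior hne] at h1
    exact closure_mono (interior_mono (subset_iUnion m.cell i)) h1
  have hopen : IsOpen m.polygon := isOpen_interior
  rw [hopen.frontier_eq] at h
  by_contra hc
  exact h ⟨hcl, hc⟩

/-- Near a point of the polygonal domain on the boundary of a triangle, there is a further
triangle. -/
theorem exists_ne_mem_cell {i : ι} {k : Fin 3} {X : Plane} (hX : X ∈ m.polygon)
    (hk : (m.tri i).coord k X = 0) : ∃ j, i ≠ j ∧ X ∈ m.cell j := by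
  -- The point is a limit of points of the polygon outside triangle `i`, and these lie in the other
  -- triangles, whose finite union is closed.
  have hcl : IsClosed (⋃ j ∈ {j | i ≠ j}, m.cell j) :=
    (toFinite _).isClosed_biUnion fun j _ => (m.isCompact_cell j).isClosed
  have h1 : X ∈ closure (m.cell i)ᶜ := by
    rw [closure_compl, interior_cell]
    intro h
    exact (h k).ne' hk
  have h2 : X ∈ closure (m.polygon ∩ (m.cell i)ᶜ) :=
    isOpen_interior.inter_closure ⟨hX, h1⟩
  have h3 : m.polygon ∩ (m.cell i)ᶜ ⊆ ⋃ j ∈ {j | i ≠ j}, m.cell j := by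
    rintro Y ⟨hY, hYi⟩
    obtain ⟨j, hj⟩ := mem_iUnion.1 (interior_subset hY)
    refine mem_biUnion (x := j) ?_ hj
    rintro rfl
    exact hYi hj
  have h4 := closure_minimal h3 hcl h2
  simp only [mem_iUnion] at h4
  obtain ⟨j, hj, hXj⟩ := h4
  exact ⟨j, hj, hXj⟩

/-- The edges at a vertex that is not a boundary vertex are shared by two triangles. -/
theorem exists_shared_edge {i : ι} {k₀ k : Fin 3} (h : m.tri i k₀ ∉ frontier m.polygon)
    (hk : k ≠ k₀) : ∃ j l, i ≠ j ∧ m.edge i k = m.edge j l := by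
  obtain ⟨k₁, hk₁, hk₁', hedge⟩ : ∃ k₁, k₁ ≠ k₀ ∧ k₁ ≠ k ∧
      m.edge i k = segment ℝ (m.tri i k₀) (m.tri i k₁) := by
    have : ∀ k₀ k : Fin 3, k ≠ k₀ → (k₀ = k + 1 ∧ k + 2 ≠ k₀ ∧ k + 2 ≠ k) ∨
      (k₀ = k + 2 ∧ k + 1 ≠ k₀ ∧ k + 1 ≠ k) := by decide
    rcases this k₀ k hk with ⟨rfl, h1, h2⟩ | ⟨rfl, h1, h2⟩
    · exact ⟨_, h1, h2, rfl⟩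
    · exact ⟨_, h1, h2, segment_symm ℝ _ _⟩
  have hcont : Filter.Tendsto (fun t : ℝ => AffineMap.lineMap (m.tri i k₀) (m.tri i k₁) t)
      (nhdsWithin 0 (Ioi 0)) (nhds (m.tri i k₀)) := by
    have : Continuous fun t : ℝ => AffineMap.lineMap (m.tri i k₀) (m.tri i k₁) t := by
      exact AffineMap.lineMap_continuous
    simpa using (this.tendsto 0).mono_left nhdsWithin_le_nhds
  -- The vertex lies in the open polygon, hence so do nearby points of the edge. Such a point
  -- belongs to a further triangle, and conformity makes both end points of the edge vertices of
  -- that triangle.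
  have hev := hcont.eventually (isOpen_interior.mem_nhds (m.vertex_mem_polygon h))
  obtain ⟨t, htX, ht0, ht1⟩ := (hev.and (Ioo_mem_nhdsGT zero_lt_one)).exists
  set X : Plane := AffineMap.lineMap (m.tri i k₀) (m.tri i k₁) t
  have hXe : X ∈ m.edge i k := by
    rw [hedge, segment_eq_image_lineMap]
    exact ⟨t, ⟨ht0.le, ht1.le⟩, rfl⟩
  obtain ⟨j, hij, hXj⟩ := m.exists_ne_mem_cell htX (m.coord_eq_zero_of_mem_edge hXe)
  have hXi := m.edge_subset_cell i k hXe
  have hc0 : (m.tri i).coord k₀ X ≠ 0 := by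
    rw [coord_lineMap, (m.tri i).coord_apply_eq, (m.tri i).coord_apply_ne hk₁.symm]
    linarith
  have hc1 : (m.tri i).coord k₁ X ≠ 0 := by
    rw [coord_lineMap, (m.tri i).coord_apply_eq, (m.tri i).coord_apply_ne hk₁]
    linarith
  obtain ⟨l₀, hl₀⟩ := m.mem_cell_of_coord_ne_zero hXi hXj hc0
  obtain ⟨l₁, hl₁⟩ := m.mem_cell_of_coord_ne_zero hXi hXj hc1
  have hl : l₀ ≠ l₁ := by
    rintro rfl
    exact hk₁ ((m.tri i).ind.injective (hl₁.symm.trans hl₀))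
  have hthird : ∀ l₀ l₁ : Fin 3, l₀ ≠ l₁ → ∃ l, (l₀ = l + 1 ∧ l₁ = l + 2) ∨
      (l₀ = l + 2 ∧ l₁ = l + 1) := by decide
  obtain ⟨l, ⟨rfl, rfl⟩ | ⟨rfl, rfl⟩⟩ := hthird l₀ l₁ hl
  · exact ⟨j, l, hij, by rw [hedge, ← hl₀, ← hl₁, edge]⟩
  · exact ⟨j, l, hij, by rw [hedge, ← hl₀, ← hl₁, edge, segment_symm]⟩

/-- The end points of a shared edge agree up to order. -/
theorem shared_edge_vertices {i j : ι} {k l : Fin 3} (h : m.edge i k = m.edge j l) :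
    (m.tri j (l + 1) = m.tri i (k + 1) ∧ m.tri j (l + 2) = m.tri i (k + 2)) ∨
      (m.tri j (l + 1) = m.tri i (k + 2) ∧ m.tri j (l + 2) = m.tri i (k + 1)) := by
  have key : ∀ k', m.tri i k' ∈ m.edge i k → ∃ l', l' ≠ l ∧ m.tri j l' = m.tri i k' := by
    intro k' hk'
    obtain ⟨l', hl'⟩ := m.mem_cell_of_coord_ne_zero (m.vertex_mem_cell i k')
      (m.edge_subset_cell j l (h ▸ hk')) (k := k') (by simp)
    refine ⟨l', ?_, hl'⟩
    rintro rfl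
    have := m.coord_eq_zero_of_mem_edge (h ▸ hk')
    rw [← hl'] at this
    simp at this
  obtain ⟨l₁, hl₁, h1⟩ := key (k + 1) (left_mem_segment ℝ _ _)
  obtain ⟨l₂, hl₂, h2⟩ := key (k + 2) (right_mem_segment ℝ _ _)
  have hne : l₁ ≠ l₂ := by
    rintro rfl
    have := (m.tri i).ind.injective (h1.symm.trans h2)
    revert this
    fin_cases k <;> decide
  have hthird : ∀ l l₁ l₂ : Fin 3, l₁ ≠ l → l₂ ≠ l → l₁ ≠ l₂ → (l₁ = l + 1 ∧ l₂ = l + 2) ∨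
      (l₁ = l + 2 ∧ l₂ = l + 1) := by decide
  rcases hthird l l₁ l₂ hl₁ hl₂ hne with ⟨rfl, rfl⟩ | ⟨rfl, rfl⟩
  · exact Or.inl ⟨h1, h2⟩
  · exact Or.inr ⟨h2, h1⟩

/-- Two triangles with a common edge lie on opposite sides of it. -/
theorem coord_opposite_neg {i j : ι} {k l : Fin 3} (hij : i ≠ j) (h : m.edge i k = m.edge j l) :
    (m.tri i).coord k (m.tri j l) < 0 := by
  by_contra! hc
  -- Otherwise both triangles would have the same vertices and coincide.
  have hnot : m.tri j l ∉ range (m.tri i) := by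
    intro hl
    have hsub : range (m.tri j) ⊆ range (m.tri i) := by
      have hcov : ∀ l l' : Fin 3, l' = l ∨ l' = l + 1 ∨ l' = l + 2 := by decide
      rintro _ ⟨l', rfl⟩
      rcases hcov l l' with rfl | rfl | rfl
      · exact hl
      · rcases m.shared_edge_vertices h with ⟨h1, h2⟩ | ⟨h1, h2⟩ <;> exact ⟨_, h1.symm⟩
      · rcases m.shared_edge_vertices h with ⟨h1, h2⟩ | ⟨h1, h2⟩ <;> exact ⟨_, h2.symm⟩
    refine hij (m.distinct i j (eq_of_subset_of_ncard_le hsub ?_ (finite_range _)).symm)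
    rw [← image_univ, ← image_univ, ncard_image_of_injective _ (m.tri i).ind.injective,
      ncard_image_of_injective _ (m.tri j).ind.injective]
  set P : Plane := midpoint ℝ (m.tri i (k + 1)) (m.tri i (k + 2)) with hP
  have hPi : P ∈ m.edge i k := midpoint_mem_segment _ _
  have hPj : P ∈ m.edge j l := h ▸ hPi
  -- near `P`, the segment from `P` to the third vertex of triangle `j` lies in triangle `i`
  have hex : ∃ t ∈ Ioo (0 : ℝ) 1,
      AffineMap.lineMap P (m.tri j l) t ∈ m.cell i := by
    have hpos : ∀ k', k' ≠ k → 0 < (m.tri i).coord k' P := by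
      intro k' hk'
      have hcov : ∀ k k' : Fin 3, k' ≠ k → (k' = k + 1 ∧ k' ≠ k + 2) ∨ (k' = k + 2 ∧ k' ≠ k + 1) := by
        decide
      rw [hP, coord_midpoint]
      rcases hcov k k' hk' with ⟨rfl, hne⟩ | ⟨rfl, hne⟩
      · rw [(m.tri i).coord_apply_eq, (m.tri i).coord_apply_ne hne]
        norm_num
      · rw [(m.tri i).coord_apply_eq, (m.tri i).coord_apply_ne hne]
        norm_num
    have hev : ∀ k', ∀ᶠ t : ℝ in nhdsWithin 0 (Ioi 0),
        0 ≤ (m.tri i).coord k' (AffineMap.lineMap P (m.tri j l) t) := by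
      intro k'
      by_cases hk' : k' = k
      · subst hk'
        filter_upwards [self_mem_nhdsWithin] with t ht
        rw [coord_lineMap, m.coord_eq_zero_of_mem_edge hPi, mul_zero, zero_add]
        exact mul_nonneg (le_of_lt ht) hc
      · have hcont : Continuous fun t : ℝ =>
            (1 - t) * (m.tri i).coord k' P + t * (m.tri i).coord k' (m.tri j l) := by fun_prop
        have h0 := (hcont.tendsto 0).mono_left (nhdsWithin_le_nhds (s := Ioi 0))
        simp only [sub_zero, one_mul, zero_mul, add_zero] at h0
        filter_upwards [h0.eventually (lt_mem_nhds (hpos k' hk'))] with t ht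
        rw [coord_lineMap]
        exact ht.le
    obtain ⟨t, ht, ht01⟩ := ((Filter.eventually_all.2 hev).and (Ioo_mem_nhdsGT zero_lt_one)).exists
    exact ⟨t, ht01, (m.mem_cell_iff).2 ht⟩
  obtain ⟨t, ⟨ht0, ht1⟩, hXi⟩ := hex
  have hXj : AffineMap.lineMap P (m.tri j l) t ∈ m.cell j :=
    (m.convex_cell j).lineMap_mem (m.edge_subset_cell j l hPj) (m.vertex_mem_cell j l)
      ⟨ht0.le, ht1.le⟩
  -- In triangle `j` the point has coordinate `t > 0` at vertex `l`, so conformity would make that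
  -- vertex common to both triangles.
  refine hnot (m.mem_cell_of_coord_ne_zero hXj hXi ?_)
  rw [coord_lineMap, m.coord_eq_zero_of_mem_edge hPj, (m.tri j).coord_apply_eq]
  linarith

end AffineTriangulation

/-! ### Determinants, interpolants and edge bubbles -/

namespace Plane

theorem abs_apply_le_norm (w : Plane) (a : Fin 2) : |w a| ≤ ‖w‖ := by
  simpa using PiLp.norm_apply_le w a

theorem abs_det_le (L : Plane →L[ℝ] Plane) : |L.det| ≤ 2 * ‖L‖ ^ 2 := by
  have h : ∀ a b, |L (EuclideanSpace.single b 1) a| ≤ ‖L‖ := fun a b =>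
    (abs_apply_le_norm _ a).trans ((L.le_opNorm _).trans (by simp))
  rw [clm_det_eq]
  calc _ ≤ _ + _ := abs_sub _ _
    _ ≤ ‖L‖ * ‖L‖ + ‖L‖ * ‖L‖ := by
      rw [abs_mul, abs_mul]
      gcongr <;> exact h _ _
    _ = _ := by ring

theorem clm_det_comp (L L' : Plane →L[ℝ] Plane) : (L.comp L').det = L.det * L'.det :=
  LinearMap.det_comp _ _

theorem contDiff_quadInterp (p : AffineBasis (Fin 3) ℝ Plane) (G : Plane → Plane) :
    ContDiff ℝ 3 (quadInterp p G) := by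
  have hc : ∀ k, ContDiff ℝ 3 (p.coord k) := fun k =>
    (smooth_barycentric_coord p k).of_le le_top
  unfold quadInterp
  refine (ContDiff.sum fun k _ => ?_).add (ContDiff.sum fun k _ => ?_)
  · exact ((hc k).mul ((contDiff_const.mul (hc k)).sub contDiff_const)).smul contDiff_const
  · exact ((contDiff_const.mul (hc _)).mul (hc _)).smul contDiff_const

/-- The derivative of an affine map plus a quadratic bubble. -/
theorem hasFDerivAt_affineMap_add_bubble {F : Plane → Plane} {p : AffineBasis (Fin 3) ℝ Plane}
    {a b : Fin 3} {d : Plane}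
    (hF : ∀ x, F x = affineMap p x + (4 * refBary a x * refBary b x) • d) (x : Plane) :
    HasFDerivAt F (affineLin p +
      ((4 * refBary a x) • refBaryLin b + (4 * refBary b x) • refBaryLin a).smulRight d) x := by
  have h := (hasFDerivAt_affineMap p x).add
    ((((hasFDerivAt_refBary a x).const_mul 4).mul (hasFDerivAt_refBary b x)).smul_const d)
  rw [funext hF]
  refine h.congr_fderiv ?_
  congr 2
  ext w
  simp
  ring

end Plane

open Plane

/-! ### The quadratic maps of an isoparametric mesh -/

namespace IsoparametricMesh

variable {ι : Type} [Fintype ι] (m : IsoparametricMesh ι)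

/-- The map `F_T` is affine up to a quadratic bubble on a single edge, which vanishes if the edge
is an interior one. -/
theorem exists_bubble (i : ι) : ∃ (k₀ : Fin 3) (d : Plane),
    (∀ x, m.F i x = affineMap (m.tri i) x + (4 * refBary (k₀ + 1) x * refBary (k₀ + 2) x) • d) ∧
    ∀ j l, i ≠ j → m.edge i k₀ = m.edge j l → d = 0 := by
  obtain ⟨k₀, hk₀⟩ := m.interior_vertex i
  refine ⟨k₀, m.G (midpoint ℝ (m.tri i (k₀ + 1)) (m.tri i (k₀ + 2))) -
    midpoint ℝ (m.tri i (k₀ + 1)) (m.tri i (k₀ + 2)), fun x => ?_, fun j l hij h => ?_⟩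
  · rw [F, Function.comp_apply, Gh, quadInterp_eq _ (m.G_vertex i), affMap,
      Finset.sum_eq_single k₀]
    · simp only [coord_affineMap]
    · intro k _ hk
      obtain ⟨j, l, hij, h⟩ := m.exists_shared_edge hk₀ hk
      rw [m.straight i j k l hij h, sub_self, smul_zero]
    · simp
  · rw [m.straight i j k₀ l hij h, sub_self]

/-- The map `F_T` is affine up to a quadratic function that vanishes on a given interior edge. -/
theorem exists_bubble_of_shared {i j : ι} {k l : Fin 3} (hij : i ≠ j)
    (h : m.edge i k = m.edge j l) : ∃ (k₁ : Fin 3) (d : Plane), k₁ ≠ k ∧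
    ∀ x, m.F i x = affineMap (m.tri i) x + (4 * refBary k x * refBary k₁ x) • d := by
  obtain ⟨k₀, d, hF, hd⟩ := m.exists_bubble i
  have hcases : ∀ k k₀ : Fin 3, k = k₀ ∨ (k₀ + 1 = k ∧ k₀ + 2 ≠ k) ∨ (k₀ + 2 = k ∧ k₀ + 1 ≠ k) := by
    decide
  rcases hcases k k₀ with rfl | ⟨rfl, hne⟩ | ⟨rfl, hne⟩
  · refine ⟨k + 1, 0, by fin_cases k <;> decide, fun x => ?_⟩
    rw [hF, hd j l hij h, smul_zero, smul_zero]
  · exact ⟨_, d, hne, hF⟩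
  · exact ⟨_, d, hne, fun x => by rw [hF, mul_right_comm]⟩

theorem curved_eq (i : ι) : m.curved i = m.F i '' refTriangle := by
  rw [curved, AffineTriangulation.cell, ← image_affineMap_refTriangle, ← image_comp]
  rfl

theorem injOn_F (i : ι) : InjOn (m.F i) refTriangle := by
  refine (m.injOn_Gh i).comp (fun x _ y _ hxy => ?_) fun x hx => affineMap_mem _ hx
  have h : ∀ k, refBary k x = refBary k y := fun k => by
    rw [← coord_affineMap (m.tri i), ← coord_affineMap (m.tri i)]
    exact congrArg _ hxy
  rw [← sum_refBary_smul x, ← sum_refBary_smul y]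
  simp only [h]

theorem dist_vertex_le (i : ι) {X Y : Plane} (hX : X ∈ m.cell i) (hY : Y ∈ m.cell i) :
    dist X Y ≤ m.size i :=
  Metric.dist_le_diam_of_mem (m.isCompact_cell i).isBounded hX hY

theorem size_pos (i : ι) : 0 < m.size i := by
  refine lt_of_lt_of_le (dist_pos.2 ?_) (m.dist_vertex_le i (m.vertex_mem_cell i 0)
    (m.vertex_mem_cell i 1))
  exact (m.tri i).ind.injective.ne (by decide)

theorem contDiff_F (i : ι) : ContDiff ℝ 2 (m.F i) :=
  ((contDiff_quadInterp _ _).of_le (by norm_num)).comp (contDiff_affineMap _)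

theorem fderiv_F (i : ι) (x : Plane) :
    fderiv ℝ (m.F i) x = (fderiv ℝ (m.Gh i) (affineMap (m.tri i) x)).comp (affineLin (m.tri i)) := by
  have h1 := ((contDiff_quadInterp (m.tri i) m.G).differentiable (by norm_num)
    (affineMap (m.tri i) x)).hasFDerivAt
  exact (h1.comp x (hasFDerivAt_affineMap (m.tri i) x)).fderiv

/-- In the constant, `|M|` serves the bounds for `DF` and its oscillation, `2 M² σ²` the lower bound
for the determinant, and `1` makes it positive. -/
theorem isQuadChart_F {σ M : ℝ} (hσ : m.ShapeRegular σ) (hM : m.MapBound M) (i : ι) :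
    IsQuadChart (|M| + 2 * M ^ 2 * σ ^ 2 + 1) (m.size i) (m.F i) := by
  have hh := m.size_pos i
  have hM' : M ≤ |M| + 2 * M ^ 2 * σ ^ 2 + 1 := by
    have := le_abs_self M
    have : 0 ≤ 2 * M ^ 2 * σ ^ 2 := by positivity
    linarith
  have hlin : ∀ b, ‖affineLin (m.tri i) (EuclideanSpace.single b 1)‖ ≤ m.size i := fun b => by
    rw [affineLin_single, ← dist_eq_norm]
    exact m.dist_vertex_le i (m.vertex_mem_cell i _) (m.vertex_mem_cell i _)
  have hcell : ∀ x ∈ refTriangle, affineMap (m.tri i) x ∈ m.cell i := fun x hx =>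
    affineMap_mem _ hx
  have hjac : ∀ x a b, jac (m.F i) a b x = fderiv ℝ (m.Gh i) (affineMap (m.tri i) x)
      (affineLin (m.tri i) (EuclideanSpace.single b 1)) a := fun x a b => by
    rw [jac, fderiv_F]
    rfl
  refine ⟨m.contDiff_F i, fun a b => ?_, fun x hx a b => ?_, fun x hx => ?_,
    fun x hx y hy a b => ?_, m.injOn_F i⟩
  · obtain ⟨k₀, d, hF, -⟩ := m.exists_bubble i
    have hpoly := (IsPolyFun.const 1 (affineLin (m.tri i) (EuclideanSpace.single b 1) a)).add
      (((isPoly_refBary (k₀ + 1)).const_mul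
        (4 * refBaryLin (k₀ + 2) (EuclideanSpace.single b 1) * d a)).add
      ((isPoly_refBary (k₀ + 2)).const_mul
        (4 * refBaryLin (k₀ + 1) (EuclideanSpace.single b 1) * d a)))
    obtain ⟨q, hq, hqf⟩ := hpoly
    refine ⟨q, hq, fun x => ?_⟩
    rw [← hqf, jac, (hasFDerivAt_affineMap_add_bubble hF x).fderiv]
    simp only [_root_.add_apply, ContinuousLinearMap.smulRight_apply, _root_.smul_apply,
      PiLp.add_apply, PiLp.smul_apply, smul_eq_mul]
    ring
  · rw [hjac]
    have hb := (hM i _ (hcell x hx)).1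
    calc _ ≤ ‖fderiv ℝ (m.Gh i) (affineMap (m.tri i) x)
          (affineLin (m.tri i) (EuclideanSpace.single b 1))‖ := abs_apply_le_norm _ _
      _ ≤ M * m.size i := ContinuousLinearMap.le_of_opNorm_le_of_le _ hb (hlin b)
      _ ≤ _ := by gcongr
  · obtain ⟨c, r, hr, hball, hhr⟩ := hσ i
    obtain ⟨-, -, hinv, hb⟩ := hM i _ (hcell x hx)
    rw [← det_fderiv_eq, fderiv_F, clm_det_comp, abs_mul]
    set D := fderiv ℝ (m.Gh i) (affineMap (m.tri i) x)
    -- The determinant of `DG_h` is bounded below because that of the inverse is at most `2 M²` in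
    -- modulus.
    have h1 : 1 ≤ 2 * M ^ 2 * |D.det| := by
      have h2 : D.det * D.inverse.det = 1 := by
        rw [← clm_det_comp, hinv.self_comp_inverse]
        exact LinearMap.det_id
      calc 1 = |D.inverse.det| * |D.det| := by rw [← abs_mul, mul_comm, h2, abs_one]
        _ ≤ (2 * ‖D.inverse‖ ^ 2) * |D.det| := by gcongr; exact abs_det_le _
        _ ≤ _ := by gcongr
    have h3 := sq_le_abs_det_affineLin (m.tri i) hr hball hh hhr
    calc m.size i ^ 2 ≤ (2 * M ^ 2 * |D.det|) * (σ ^ 2 * |(affineLin (m.tri i)).det|) := by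
          refine h3.trans (le_mul_of_one_le_left (by positivity) h1)
      _ = (2 * M ^ 2 * σ ^ 2) * (|D.det| * |(affineLin (m.tri i)).det|) := by ring
      _ ≤ _ := by
        gcongr
        linarith [abs_nonneg M]
  -- Mean value inequality on the convex affine triangle, with the bound for the second derivative
  -- of `G_h`. One power of `h` comes from the distance, the other from the affine map.
  · have hmv : ‖fderiv ℝ (m.Gh i) (affineMap (m.tri i) y) -
        fderiv ℝ (m.Gh i) (affineMap (m.tri i) x)‖ ≤ M * m.size i := by
      have hd : Differentiable ℝ (fderiv ℝ (m.Gh i)) :=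
        ((contDiff_quadInterp (m.tri i) m.G).fderiv_right (m := 1) (by norm_num)).differentiable
          (by norm_num)
      refine ((m.convex_cell i).norm_image_sub_le_of_norm_fderiv_le (fun X _ => hd X)
        (fun X hX => (hM i X hX).2.1) (hcell x hx) (hcell y hy)).trans ?_
      have hM0 : 0 ≤ M := (norm_nonneg _).trans (hM i _ (hcell x hx)).1
      gcongr
      rw [← dist_eq_norm]
      exact m.dist_vertex_le i (hcell y hy) (hcell x hx)
    rw [hjac, hjac, ← PiLp.sub_apply, ← _root_.sub_apply]
    calc _ ≤ ‖_‖ := abs_apply_le_norm _ _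
      _ ≤ (M * m.size i) * m.size i := ContinuousLinearMap.le_of_opNorm_le_of_le _ hmv (hlin b)
      _ = M * m.size i ^ 2 := by ring
      _ ≤ _ := by gcongr

theorem refBary_refEdge_self (k : Fin 3) (t : ℝ) : refBary k (refEdge k t) = 0 := by
  rw [refBary_refEdge]
  fin_cases k <;> simp

/-- On interior edges, `F_T` is the affine parametrization. -/
theorem F_refEdge {i j : ι} {k l : Fin 3} (hij : i ≠ j) (h : m.edge i k = m.edge j l) (t : ℝ) :
    m.F i (refEdge k t) = AffineMap.lineMap (m.tri i (k + 1)) (m.tri i (k + 2)) t := by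
  obtain ⟨k₁, d, -, hF⟩ := m.exists_bubble_of_shared hij h
  rw [hF, refBary_refEdge_self, mul_zero, zero_mul, zero_smul, add_zero, affineMap_refEdge]

end IsoparametricMesh

/-! ### Unit normals and the Frobenius norm -/

namespace Plane

/-- Two unit vectors of the plane that are orthogonal to the same nonzero vector are equal or
opposite. -/
theorem eq_or_eq_neg_of_inner_eq_zero {n n' τ : Plane} (hτ : τ ≠ 0) (hn : ‖n‖ = 1) (hn' : ‖n'‖ = 1)
    (h : inner ℝ n τ = 0) (h' : inner ℝ n' τ = 0) : n' = n ∨ n' = -n := by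
  have e : n 0 ^ 2 + n 1 ^ 2 = 1 := by
    have := EuclideanSpace.real_norm_sq_eq n
    rw [hn, Fin.sum_univ_two] at this
    linarith
  have e' : n' 0 ^ 2 + n' 1 ^ 2 = 1 := by
    have := EuclideanSpace.real_norm_sq_eq n'
    rw [hn', Fin.sum_univ_two] at this
    linarith
  simp only [PiLp.inner_apply, Fin.sum_univ_two, RCLike.inner_apply, conj_trivial] at h h'
  have hcross : n 0 * n' 1 - n 1 * n' 0 = 0 := by
    by_contra hc
    refine hτ ?_
    ext a
    fin_cases a
    · refine (mul_eq_zero.1 (?_ : (n 0 * n' 1 - n 1 * n' 0) * τ 0 = 0)).resolve_left hc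
      linear_combination n' 1 * h - n 1 * h'
    · refine (mul_eq_zero.1 (?_ : (n 0 * n' 1 - n 1 * n' 0) * τ 1 = 0)).resolve_left hc
      linear_combination n 0 * h' - n' 0 * h
  set s := n 0 * n' 0 + n 1 * n' 1 with hs
  have hs2 : s ^ 2 = 1 := by
    rw [hs]
    linear_combination (n' 0 ^ 2 + n' 1 ^ 2) * e + e' -
      (n 0 * n' 1 - n 1 * n' 0) * hcross
  have h0 : n' 0 = s * n 0 := by rw [hs]; linear_combination (-n' 0) * e - n 1 * hcross
  have h1 : n' 1 = s * n 1 := by rw [hs]; linear_combination (-n' 1) * e + n 0 * hcross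
  rcases (by simpa using hs2 : s = 1 ∨ s = -1) with hs1 | hs1
  · left
    ext a
    fin_cases a <;> simp [h0, h1, hs1]
  · right
    ext a
    fin_cases a <;> simp [h0, h1, hs1]

/-- For a normal to edge `k`, the side of the edge on which `X` lies is read off from the coordinate
`k` alone. -/
theorem inner_sub_vertex_eq (p : AffineBasis (Fin 3) ℝ Plane) {n : Plane} {k : Fin 3}
    (h : inner ℝ n (p (k + 2) - p (k + 1)) = 0) (X : Plane) :
    inner ℝ n (X - p (k + 1)) = p.coord k X * inner ℝ n (p k - p (k + 1)) := by
  rw [sub_eq_coord_smul p k X, inner_add_right, inner_smul_right, inner_smul_right, h, mul_zero,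
    add_zero]

theorem frobNorm_le {J : Matrix (Fin 2) (Fin 2) ℝ} {B : ℝ} (h : ∀ a b, |J a b| ≤ B) :
    frobNorm J ≤ 2 * B := by
  have hB : 0 ≤ B := (abs_nonneg _).trans (h 0 0)
  have hsq : ∀ a b, J a b ^ 2 ≤ B ^ 2 := fun a b => sq_le_sq' (abs_le.1 (h a b)).1 (abs_le.1 (h a b)).2
  rw [frobNorm, ← Real.sqrt_sq (show 0 ≤ 2 * B by positivity)]
  refine Real.sqrt_le_sqrt ?_
  simp only [Fin.sum_univ_two]
  linarith [hsq 0 0, hsq 0 1, hsq 1 0, hsq 1 1]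

end Plane

open Plane

/-! ### Outward normals and one-sided estimates at interior edges -/

namespace IsoparametricMesh

variable {ι : Type} [Fintype ι] (m : IsoparametricMesh ι)

/-- The factor by which `DF_T` scales the component transversal to an interior edge is positive,
because it is nonzero along the edge and one at an end point. -/
theorem bubble_coord_pos {i : ι} {k k₁ : Fin 3} {d : Plane} (hk : k₁ ≠ k)
    (hdet : ∀ x ∈ refTriangle, jacDet (m.F i) x ≠ 0)
    (hF : ∀ x, m.F i x = affineMap (m.tri i) x + (4 * refBary k x * refBary k₁ x) • d) :
    0 < 1 + 2 * (m.tri i).coord k (m.tri i (k + 1) + d) := by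
  obtain ⟨y, hy, hyb⟩ := exists_affineMap_eq (m.tri i) (m.tri i (k + 1) + d)
  set δ := (m.tri i).coord k (m.tri i (k + 1) + d) with hδ
  have hkk : k ≠ k + 1 := by fin_cases k <;> decide
  have hB : affineLin (m.tri i) (y - refVertex (k + 1)) = d := by
    rw [affineLin_sub, hy, affineMap_refVertex, add_sub_cancel_left]
  have hb : refBaryLin k (y - refVertex (k + 1)) = δ := by
    rw [refBaryLin_sub, hyb, refBary_refVertex, if_neg hkk, sub_zero]
  by_contra! hc
  have hδneg : δ < 0 := by linarith
  -- Where `refBary k₁` equals `s` on the edge, the transversal factor is `1 + 4 s δ`. This is the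
  -- zero of that factor, and `δ ≤ -1/2` puts it in the unit interval; there `DF` annihilates the
  -- preimage of `d` under the affine part.
  set s := -1 / (4 * δ) with hs
  have hsδ : 1 + 4 * s * δ = 0 := by
    have : δ ≠ 0 := hδneg.ne
    rw [hs]
    field_simp
    ring
  have hs0 : 0 ≤ s := div_nonneg_of_nonpos (by norm_num) (by linarith)
  have hs1 : s ≤ 1 := by
    rw [hs, div_le_iff_of_neg (by linarith)]
    linarith
  obtain ⟨t, ht, htk⟩ : ∃ t ∈ Icc (0 : ℝ) 1, refBary k₁ (refEdge k t) = s := by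
    have hcases : ∀ k k₁ : Fin 3, k₁ ≠ k → (k₁ = k + 1 ∧ k₁ ≠ k + 2) ∨ (k₁ = k + 2 ∧ k₁ ≠ k + 1) := by
      decide
    rcases hcases k k₁ hk with ⟨h1, h2⟩ | ⟨h1, h2⟩
    · exact ⟨1 - s, ⟨by linarith, by linarith⟩, by
        rw [refBary_refEdge, if_pos h1, if_neg h2]; ring⟩
    · exact ⟨s, ⟨hs0, hs1⟩, by rw [refBary_refEdge, if_pos h1, if_neg h2]; ring⟩
  have hD : fderiv ℝ (m.F i) (refEdge k t) (y - refVertex (k + 1)) = 0 := by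
    rw [(hasFDerivAt_affineMap_add_bubble hF _).fderiv]
    simp only [_root_.add_apply, ContinuousLinearMap.smulRight_apply, _root_.smul_apply,
      refBary_refEdge_self, htk, hB, hb, smul_eq_mul]
    rw [show d + (4 * 0 * refBaryLin k₁ (y - refVertex (k + 1)) + 4 * s * δ) • d =
      (1 + 4 * s * δ) • d by module, hsδ, zero_smul]
  have hdt := hdet _ (refEdge_mem k ht)
  rw [← det_fderiv_eq] at hdt
  have h0 : y - refVertex (k + 1) = 0 := by
    have := ((fderiv ℝ (m.F i) (refEdge k t)).toContinuousLinearEquivOfDetNeZero hdt).injective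
      (a₁ := y - refVertex (k + 1)) (a₂ := 0)
    simp only [ContinuousLinearMap.toContinuousLinearEquivOfDetNeZero_apply, map_zero] at this
    exact this hD
  rw [h0, map_zero] at hb
  exact hδneg.ne hb.symm

/-- An outward normal along an interior edge is orthogonal to the edge and points away from the
affine triangle. -/
theorem IsOutwardNormal.inner_vertex {m : IsoparametricMesh ι} {i j : ι} {k l : Fin 3} {n : Plane}
    (hn : m.IsOutwardNormal i k n) (hij : i ≠ j) (h : m.edge i k = m.edge j l)
    (hdet : ∀ x ∈ refTriangle, jacDet (m.F i) x ≠ 0) :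
    inner ℝ n (m.tri i (k + 2) - m.tri i (k + 1)) = 0 ∧
      inner ℝ n (m.tri i k - m.tri i (k + 1)) < 0 := by
  obtain ⟨k₁, d, hk, hF⟩ := m.exists_bubble_of_shared hij h
  have hk1 : k ≠ k + 1 := by fin_cases k <;> decide
  have hk2 : k ≠ k + 2 := by fin_cases k <;> decide
  set p := m.tri i (k + 1)
  set q := m.tri i (k + 2)
  have hmem : refEdge k (1 / 2) ∈ openSegment ℝ (refVertex (k + 1)) (refVertex (k + 2)) := by
    rw [openSegment_eq_image_lineMap]
    exact ⟨1 / 2, by norm_num, rfl⟩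
  have haff : affineMap (m.tri i) (refEdge k (1 / 2)) = (1 / 2 : ℝ) • (p + q) := by
    rw [affineMap_refEdge, AffineMap.lineMap_apply_module]
    module
  have hD : ∀ j, fderiv ℝ (m.F i) (refEdge k (1 / 2)) (refVertex j - refEdge k (1 / 2)) =
      m.tri i j - (1 / 2 : ℝ) • (p + q) +
        (4 * refBary k₁ (refEdge k (1 / 2)) * (if k = j then 1 else 0)) • d := by
    intro j
    rw [(hasFDerivAt_affineMap_add_bubble hF _).fderiv]
    simp only [_root_.add_apply, ContinuousLinearMap.smulRight_apply, _root_.smul_apply,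
      refBary_refEdge_self, smul_eq_mul, refBaryLin_sub, affineLin_sub, affineMap_refVertex, haff,
      refBary_refVertex]
    module
  -- The directions from the edge midpoint to the two end points are opposite, so the two
  -- inequalities give orthogonality to the edge. The direction to the third vertex gives the sign,
  -- by positivity of the transversal factor `1 + 2 δ`.
  have hin := fun j => hn.2 _ hmem (refVertex j) (refVertex_mem j)
  have h1 := hin (k + 1)
  have h2 := hin (k + 2)
  have h3 := hin k
  rw [hD, if_neg hk1, mul_zero, zero_smul, add_zero,
    show p - (1 / 2 : ℝ) • (p + q) = (-1 / 2 : ℝ) • (q - p) by module, inner_smul_right] at h1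
  rw [hD, if_neg hk2, mul_zero, zero_smul, add_zero,
    show q - (1 / 2 : ℝ) • (p + q) = (1 / 2 : ℝ) • (q - p) by module, inner_smul_right] at h2
  have hτ : inner ℝ n (q - p) = 0 := by linarith
  have hβ : refBary k₁ (refEdge k (1 / 2)) = 1 / 2 := by
    have hcases : ∀ k k₁ : Fin 3, k₁ ≠ k → (k₁ = k + 1 ∧ k₁ ≠ k + 2) ∨ (k₁ = k + 2 ∧ k₁ ≠ k + 1) := by
      decide
    rw [refBary_refEdge]
    rcases hcases k k₁ hk with ⟨h1, h2⟩ | ⟨h1, h2⟩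
    · rw [if_pos h1, if_neg h2]; norm_num
    · rw [if_pos h1, if_neg h2]; norm_num
  have hvert := inner_sub_vertex_eq (m.tri i) hτ
  have hd : inner ℝ n d = (m.tri i).coord k (p + d) * inner ℝ n (m.tri i k - p) := by
    rw [← hvert, add_sub_cancel_left]
  have hpos := m.bubble_coord_pos hk hdet hF
  rw [hD, if_pos rfl, hβ, show m.tri i k - (1 / 2 : ℝ) • (p + q) + (4 * (1 / 2) * 1 : ℝ) • d =
    (m.tri i k - p) + (-1 / 2 : ℝ) • (q - p) + (2 : ℝ) • d by module, inner_add_right,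
    inner_add_right, inner_smul_right, inner_smul_right, hτ, hd] at h3
  have hle : inner ℝ n (m.tri i k - p) ≤ 0 := by
    by_contra! hc
    have := mul_pos hpos hc
    linarith
  refine ⟨hτ, hle.lt_of_ne fun h0 => ?_⟩
  -- If the product vanished, `n` would be orthogonal to all vectors, itself included.
  have hself := hvert (p + n)
  rw [add_sub_cancel_left, real_inner_self_eq_norm_sq, hn.1, h0] at hself
  norm_num at hself

/-- The outward normals of the two triangles at an interior edge are opposite. -/
theorem IsOutwardNormal.eq_neg {m : IsoparametricMesh ι} {i j : ι} {k l : Fin 3} {n n' : Plane}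
    (hn : m.IsOutwardNormal i k n) (hn' : m.IsOutwardNormal j l n') (hij : i ≠ j)
    (h : m.edge i k = m.edge j l) (hdet : ∀ i, ∀ x ∈ refTriangle, jacDet (m.F i) x ≠ 0) :
    n' = -n := by
  obtain ⟨h1, h2⟩ := hn.inner_vertex hij h (hdet i)
  obtain ⟨h1', h2'⟩ := hn'.inner_vertex hij.symm h.symm (hdet j)
  have hneg := m.coord_opposite_neg hij h
  have hpos : 0 < inner ℝ n (m.tri j l - m.tri i (k + 1)) := by
    rw [inner_sub_vertex_eq (m.tri i) h1]
    exact mul_pos_of_neg_of_neg hneg h2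
  have hτ : m.tri i (k + 2) - m.tri i (k + 1) ≠ 0 := by
    refine sub_ne_zero.2 ((m.tri i).ind.injective.ne ?_)
    fin_cases k <;> decide
  have key : inner ℝ n' (m.tri i (k + 2) - m.tri i (k + 1)) = 0 ∧
      inner ℝ n' (m.tri j l - m.tri i (k + 1)) < 0 := by
    rcases m.shared_edge_vertices h with ⟨e1, e2⟩ | ⟨e1, e2⟩
    · rw [← e1, ← e2]
      exact ⟨h1', h2'⟩
    · rw [← e1, ← e2]
      refine ⟨by rw [← neg_sub, inner_neg_right, h1', neg_zero], ?_⟩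
      rw [← sub_sub_sub_cancel_right (m.tri j l) (m.tri j (l + 2)) (m.tri j (l + 1)),
        inner_sub_right, h1', sub_zero]
      exact h2'
  -- Equal normals are excluded by vertex `l` of triangle `j`, which lies beyond the edge for `n`
  -- and on the inner side for `n'`.
  refine (eq_or_eq_neg_of_inner_eq_zero hτ hn.1 hn'.1 h1 key.1).resolve_left ?_
  rintro rfl
  exact lt_asymm hpos key.2

/-- The estimate for one of the triangles at an interior edge, in either orientation of the
edge. -/
theorem edge_estimate {K C : ℝ}
    (hC : ∀ {h : ℝ} {F v w : Plane → Plane}, IsQuadChart K h F → 0 < h → w ∈ refVelocity →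
      (∀ x ∈ refTriangle, v (F x) = ((fderiv ℝ F x).det⁻¹ • fderiv ℝ F x) (w x)) →
      IntegrableOn (gradSq v) (F '' refTriangle) ∧ ∀ (k : Fin 3) (a : Fin 2),
        ContinuousOn (fun t => v (F (refEdge k t)) a) (Icc 0 1) ∧
        |simpsonError (fun t => v (F (refEdge k t)) a)| ≤
          C * h ^ 2 * gradNorm (F '' refTriangle) v)
    {i j : ι} {k l : Fin 3} (hij : i ≠ j) (h : m.edge i k = m.edge j l)
    (hF : IsQuadChart K (m.size i) (m.F i)) {v u : Plane → Plane} (hv : v ∈ m.localVelocity i)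
    (hu : ∀ x ∈ refNodes, v (m.F i x) = u (m.affMap i x)) {P Q : Plane}
    (hPQ : (m.tri i (k + 1) = P ∧ m.tri i (k + 2) = Q) ∨
      (m.tri i (k + 1) = Q ∧ m.tri i (k + 2) = P)) :
    IntegrableOn (gradSq v) (m.curved i) ∧
      (∀ t : ℝ, t = 0 ∨ t = 1 / 2 ∨ t = 1 →
        v (AffineMap.lineMap P Q t) = u (AffineMap.lineMap P Q t)) ∧
      ∀ a, ContinuousOn (fun t : ℝ => v (AffineMap.lineMap P Q t) a) (Icc 0 1) ∧
        |simpsonError (fun t : ℝ => v (AffineMap.lineMap P Q t) a)| ≤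
          C * m.size i ^ 2 * gradNorm (m.curved i) v := by
  obtain ⟨w, hw, hvw⟩ := hv.2
  obtain ⟨hint, hest⟩ := hC hF (m.size_pos i) hw hvw
  rw [m.curved_eq]
  have hline : ∀ t, m.F i (refEdge k t) = AffineMap.lineMap (m.tri i (k + 1)) (m.tri i (k + 2)) t :=
    m.F_refEdge hij h
  have hnode : ∀ t : ℝ, t = 0 ∨ t = 1 / 2 ∨ t = 1 → v (m.F i (refEdge k t)) =
      u (AffineMap.lineMap (m.tri i (k + 1)) (m.tri i (k + 2)) t) := by
    intro t ht
    rw [hu _ (refEdge_mem_refNodes k ht), affMap, affineMap_refEdge]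
  have hest' := hest k
  simp only [hline] at hest' hnode
  refine ⟨hint, ?_⟩
  rcases hPQ with ⟨rfl, rfl⟩ | ⟨rfl, rfl⟩
  · exact ⟨hnode, hest'⟩
  · have hrev : ∀ t : ℝ, AffineMap.lineMap (m.tri i (k + 2)) (m.tri i (k + 1)) t =
        AffineMap.lineMap (m.tri i (k + 1)) (m.tri i (k + 2)) (1 - t) := fun t =>
      (AffineMap.lineMap_apply_one_sub _ _ _).symm
    simp only [hrev]
    refine ⟨fun t ht => hnode _ ?_, fun a => ⟨?_, ?_⟩⟩
    · rcases ht with rfl | rfl | rfl <;> norm_num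
    · have hmaps : MapsTo (fun t : ℝ => 1 - t) (Icc 0 1) (Icc 0 1) := fun t ht =>
        ⟨by linarith [ht.2], by linarith [ht.1]⟩
      have hsub : ContinuousOn (fun t : ℝ => 1 - t) (Icc 0 1) := by fun_prop
      exact (hest' a).1.comp hsub hmaps
    · rw [simpsonError_reflect fun t =>
        v (AffineMap.lineMap (m.tri i (k + 1)) (m.tri i (k + 2)) t) a]
      exact (hest' a).2

end IsoparametricMesh

/-! ### The estimate of the jump -/

theorem mainTheorem11 (σ M : ℝ) :
    ∃ C : ℝ, 0 < C ∧
      ∀ (ι : Type) [Fintype ι] (m : IsoparametricMesh ι), m.ShapeRegular σ → m.MapBound M →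
      ∀ (i j : ι) (k l : Fin 3), i ≠ j → m.edge i k = m.edge j l →
      ∀ np nn : Plane, m.IsOutwardNormal i k np → m.IsOutwardNormal j l nn →
      ∀ v ∈ m.velocity,
        (∀ a b : Fin 2, IntervalIntegrable
          (fun t : ℝ => jump (v i) (v j) np nn
            (AffineMap.lineMap (m.tri i (k + 1)) (m.tri i (k + 2)) t) a b)
          MeasureTheory.volume 0 1) ∧
        MeasureTheory.IntegrableOn (Plane.gradSq (v i)) (m.curved i) ∧
        MeasureTheory.IntegrableOn (Plane.gradSq (v j)) (m.curved j) ∧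
        frobNorm (edgeIntegral (m.tri i (k + 1)) (m.tri i (k + 2))
            (jump (v i) (v j) np nn)) ≤
          C * max (m.size i) (m.size j) ^ 3 *
            (Plane.gradNorm (m.curved i) (v i) + Plane.gradNorm (m.curved j) (v j)) := by
  obtain ⟨C, hC0, hC⟩ := exists_abs_simpsonError_le
    (show 0 < |M| + 2 * M ^ 2 * σ ^ 2 + 1 by positivity)
  -- The factor two bounds the Frobenius norm of a two by two matrix by its largest entry; `C` may
  -- vanish, so one is added.
  refine ⟨2 * C + 1, by positivity, ?_⟩
  intro ι _ m hσ hM i j k l hij h np nn hnp hnn v hv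
  obtain ⟨u, -, hv⟩ := hv
  have hchart := m.isQuadChart_F hσ hM
  have hnorm : nn = -np := hnp.eq_neg hnn hij h fun i x hx =>
    (hchart i).jacDet_ne_zero (m.size_pos i) hx
  obtain ⟨hi1, hi2, hi3⟩ := m.edge_estimate hC hij h (hchart i) (hv i).1 (hv i).2
    (Or.inl ⟨rfl, rfl⟩)
  obtain ⟨hj1, hj2, hj3⟩ := m.edge_estimate hC hij.symm h.symm (hchart j) (hv j).1 (hv j).2
    (m.shared_edge_vertices h)
  set p := m.tri i (k + 1)
  set q := m.tri i (k + 2)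
  set f : Fin 2 → ℝ → ℝ := fun a t => v i (AffineMap.lineMap p q t) a
  set g : Fin 2 → ℝ → ℝ := fun a t => v j (AffineMap.lineMap p q t) a
  have hfi : ∀ a, IntervalIntegrable (f a) volume 0 1 := fun a =>
    (hi3 a).1.intervalIntegrable_of_Icc zero_le_one
  have hgi : ∀ a, IntervalIntegrable (g a) volume 0 1 := fun a =>
    (hj3 a).1.intervalIntegrable_of_Icc zero_le_one
  have hjump : ∀ a b, (fun t : ℝ => jump (v i) (v j) np nn (AffineMap.lineMap p q t) a b) =
      fun t => (f a t - g a t) * np b := by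
    intro a b
    ext t
    simp [jump, hnorm, f, g]
    ring
  refine ⟨fun a b => ?_, hi1, hj1, ?_⟩
  · rw [hjump]
    exact ((hfi a).sub (hgi a)).mul_const _
  set H := max (m.size i) (m.size j)
  have hHi : m.size i ≤ H := le_max_left _ _
  have hHj : m.size j ≤ H := le_max_right _ _
  have hi0 := (m.size_pos i).le
  have hj0 := (m.size_pos j).le
  have hH0 : 0 ≤ H := hi0.trans hHi
  have hGi : 0 ≤ gradNorm (m.curved i) (v i) := Real.sqrt_nonneg _
  have hGj : 0 ≤ gradNorm (m.curved j) (v j) := Real.sqrt_nonneg _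
  have hentry : ∀ a b, |edgeIntegral p q (jump (v i) (v j) np nn) a b| ≤
      H * ((C * H ^ 2 * gradNorm (m.curved i) (v i) + C * H ^ 2 * gradNorm (m.curved j) (v j)) *
        1) := by
    intro a b
    have hnodes : ∀ t : ℝ, t = 0 ∨ t = 1 / 2 ∨ t = 1 → f a t = g a t := fun t ht => by
      simp only [f, g, hi2 t ht, hj2 t ht]
    -- The Simpson sums of both traces are equal, as both traces agree with `u` at the three nodes.
    have hE : (∫ t in (0 : ℝ)..1, f a t) - ∫ t in (0 : ℝ)..1, g a t =
        simpsonError (f a) - simpsonError (g a) := by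
      rw [simpsonError, simpsonError, hnodes 0 (by simp), hnodes (1 / 2) (by simp),
        hnodes 1 (by simp)]
      ring
    have hnb : |np b| ≤ 1 := hnp.1 ▸ abs_apply_le_norm np b
    have hval : edgeIntegral p q (jump (v i) (v j) np nn) a b =
        dist p q * ((simpsonError (f a) - simpsonError (g a)) * np b) := by
      rw [edgeIntegral, Matrix.of_apply, hjump, intervalIntegral.integral_mul_const,
        intervalIntegral.integral_sub (hfi a) (hgi a), hE]
    rw [hval, abs_mul, abs_mul, abs_of_nonneg dist_nonneg]
    have hd : dist p q ≤ H :=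
      (m.dist_vertex_le i (m.vertex_mem_cell i _) (m.vertex_mem_cell i _)).trans hHi
    gcongr
    calc |simpsonError (f a) - simpsonError (g a)|
        ≤ |simpsonError (f a)| + |simpsonError (g a)| := abs_sub _ _
      _ ≤ C * m.size i ^ 2 * gradNorm (m.curved i) (v i) +
          C * m.size j ^ 2 * gradNorm (m.curved j) (v j) := add_le_add (hi3 a).2 (hj3 a).2
      _ ≤ _ := by gcongr
  refine (frobNorm_le hentry).trans ?_
  calc _ = (2 * C) * H ^ 3 * (gradNorm (m.curved i) (v i) + gradNorm (m.curved j) (v j)) := by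
        ring
    _ ≤ _ := by
      gcongr
      linarith

end
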